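/- **Theorem 2.** Let $\Sigma$ be a finite alphabet. Series-parallel words over $\Sigma$ are built from the empty word $\varepsilon$ and the letters by an associative sequential product $\cdot$ and an associative, commutative parallel product $\|$, with $\varepsilon$ neutral for both; $SP(\Sigma)$ is the set of these words (that is, terms modulo these laws), and $\Sigma^{\oplus}\subseteq SP(\Sigma)$ is the set of parallel words $a_1\|\cdots\|a_n$ ($n\ge 0$, $a_i\in\Sigma$). * A language $L\subseteq\Sigma^{\oplus}$ is *parallel regular* if it belongs to the least class of subsets of $SP(\Sigma)$ that contains $\emptyset$ and $\{a\}$ for each $a\in\Sigma$ and is closed under $L_1\cup L_2$, $L_1\cdot L_2$, $L_1\|L_2$ and $L^{\oplus}=\bigcup_{n\ge 0}L_n$, where $L_0=\{\varepsilon\}$ and $L_{n+1}=L_n\|L$. * A *linear (parallel regular) grammar* $G=(V,\Sigma,P,S)$ has a finite set $V$ of variables, a start symbol $S\in V$, and a finite set $P$ of productions, each of the form $A\to x\|B$, $A\to B\|x$ or $A\to x$ with $A,B\in V$, $x\in\Sigma^{\oplus}$; $L(G)$ is the set of all $w\in\Sigma^{\oplus}$ that are derivable from $S$, where a derivation step replaces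 $A\|\gamma$ by $\beta\|\gamma$ for a production $A\to\beta$. * A *branching automaton* $\mathbf A=(Q,T_{seq},T_{fork},T_{join},T_{par},S,E)$ over $\Sigma$ has a finite set $Q$ of states, sets $S,E\subseteq Q$ of start and end states, and finite sets of transitions $T_{seq}\subseteq Q\times\Sigma\times Q$, $T_{fork}\subseteq Q\times M_{ns}(Q)$, $T_{join}\subseteq M_{ns}(Q)\times Q$ and $T_{par}\subseteq T_{fork}\times\Sigma^{\oplus}\times T_{join}$, where $M_{ns}(Q)$ is the set of multisets over $Q$ of cardinality at least $2$. Its runs, written $p\xrightarrow{x}q$ with $p,q\in Q$ and $x\in SP(\Sigma)$, are generated by the following rules: $p\xrightarrow{\varepsilon}p$; $p\xrightarrow{a}q$ if $(p,a,q)\in T_{seq}$; $p\xrightarrow{x\cdot y}r$ if $p\xrightarrow{x}q$ and $q\xrightarrow{y}r$; $p\xrightarrow{x_1\|\cdots\|x_n}q$ if $(p,\{p_1,\dots,p_n\})\in T_{fork}$, $(\{q_1,\dots,q_n\},q)\in T_{join}$ and $p_i\xrightarrow{x_i}q_i$ for all $i$; $p\xrightarrow{w}q$ if $((p,M),w,(N,q))\in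 T_{par}$ for some $M,N$. The language $L(\mathbf A)$ is the set of all $x$ with $p\xrightarrow{x}q$ for some $p\in S$, $q\in E$. Then for every language $L\subseteq\Sigma^{\oplus}$ of parallel words the following are equivalent: 1. $L$ is parallel regular; 2. $L=L(G)$ for some linear grammar $G$; 3. $L$ is recognized by a branching automaton, i.e. $L=L(\mathbf A)$ for some $\mathbf A$; 4. $L=L(\mathbf A)\cap\Sigma^{\oplus}$ for some branching automaton $\mathbf A$. In particular, for a linear grammar $G$, the language $L(G)$ is parallel regular if and only if it is recognized by a branching automaton. -/

import Mathlib

universe u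

/-- Series-parallel terms over `α`: built from the empty word and letters by sequential
composition `x · y` and parallel composition `x ‖ y`. -/
inductive SPTerm (α : Type u) : Type u
  | empty : SPTerm α
  | letter (a : α) : SPTerm α
  | seq (x y : SPTerm α) : SPTerm α
  | par (x y : SPTerm α) : SPTerm α

/-- The congruence on terms generated by: `·` is associative, `‖` is associative and commutative,
and the empty word is neutral for both. -/
inductive SPTerm.Equiv {α : Type u} : SPTerm α → SPTerm α → Prop
  | refl (x) : Equiv x x
  | symm {x y} : Equiv x y → Equiv y x
  | trans {x y z} : Equiv x y → Equiv y z → Equiv x z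
  | seq_congr {x x' y y'} : Equiv x x' → Equiv y y' → Equiv (.seq x y) (.seq x' y')
  | par_congr {x x' y y'} : Equiv x x' → Equiv y y' → Equiv (.par x y) (.par x' y')
  | seq_assoc (x y z) : Equiv (.seq (.seq x y) z) (.seq x (.seq y z))
  | empty_seq (x) : Equiv (.seq .empty x) x
  | seq_empty (x) : Equiv (.seq x .empty) x
  | par_assoc (x y z) : Equiv (.par (.par x y) z) (.par x (.par y z))
  | par_comm (x y) : Equiv (.par x y) (.par y x)
  | empty_par (x) : Equiv (.par .empty x) x

instance SPTerm.setoid (α : Type u) : Setoid (SPTerm α) where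
  r := SPTerm.Equiv
  iseqv := ⟨.refl, .symm, .trans⟩

/-- Series-parallel words over `α` (including the empty word). -/
def SPWord (α : Type u) : Type u := Quotient (SPTerm.setoid α)

namespace SPWord

variable {α : Type u}

/-- The empty word. -/
def empty : SPWord α := Quotient.mk _ SPTerm.empty

/-- The one-letter word `a`. -/
def letter (a : α) : SPWord α := Quotient.mk _ (SPTerm.letter a)

/-- Sequential composition `x · y`. -/
def seq (x y : SPWord α) : SPWord α :=
  Quotient.map₂ SPTerm.seq (fun _ _ h _ _ h' => SPTerm.Equiv.seq_congr h h') x y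

/-- Parallel composition `x ‖ y`. -/
def par (x y : SPWord α) : SPWord α :=
  Quotient.map₂ SPTerm.par (fun _ _ h _ _ h' => SPTerm.Equiv.par_congr h h') x y

theorem par_comm (x y : SPWord α) : par x y = par y x := by
  induction x using Quotient.inductionOn
  induction y using Quotient.inductionOn
  exact Quotient.sound (SPTerm.Equiv.par_comm _ _)

theorem par_assoc (x y z : SPWord α) : par (par x y) z = par x (par y z) := by
  induction x using Quotient.inductionOn
  induction y using Quotient.inductionOn
  induction z using Quotient.inductionOn
  exact Quotient.sound (SPTerm.Equiv.par_assoc _ _ _)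

instance : LeftCommutative (fun (a : α) (x : SPWord α) => par (letter a) x) where
  left_comm a b x := by
    rw [← par_assoc, par_comm (letter a), par_assoc]

end SPWord

/-- Parallel words `a₁ ‖ ⋯ ‖ aₙ` (`n ≥ 0`) over `α`, i.e. the elements of `α^⊕`. As `‖` is
associative and commutative, such a word is the multiset of its letters. -/
abbrev ParWord (α : Type u) : Type u := Multiset α

/-- The parallel word `a₁ ‖ ⋯ ‖ aₙ` as a series-parallel word. -/
def ParWord.toSP {α : Type u} (w : ParWord α) : SPWord α :=
  Multiset.foldr (fun a x => SPWord.par (SPWord.letter a) x) SPWord.empty w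

section RegularLanguages

variable {α : Type u}

/-- `L₁ · L₂ = {x · y | x ∈ L₁, y ∈ L₂}`. -/
def seqLang (L₁ L₂ : Set (SPWord α)) : Set (SPWord α) := Set.image2 SPWord.seq L₁ L₂

/-- `L₁ ‖ L₂ = {x ‖ y | x ∈ L₁, y ∈ L₂}`. -/
def parLang (L₁ L₂ : Set (SPWord α)) : Set (SPWord α) := Set.image2 SPWord.par L₁ L₂

/-- `L_n = L ‖ ⋯ ‖ L` (`n` factors), with `L_0 = {ε}`. -/
def parPow (L : Set (SPWord α)) : ℕ → Set (SPWord α)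
  | 0 => {SPWord.empty}
  | n + 1 => parLang (parPow L n) L

/-- The parallel Kleene closure `L^⊕ = ⋃ n ≥ 0, L_n`. -/
def parStar (L : Set (SPWord α)) : Set (SPWord α) := ⋃ n, parPow L n

/-- The languages denoted by parallel regular expressions: the least class that contains `∅` and
all `{a}` and is closed under `∪`, `·`, `‖` and `⊕`. -/
inductive IsParallelRational : Set (SPWord α) → Prop
  | empty : IsParallelRational ∅
  | letter (a : α) : IsParallelRational {SPWord.letter a}
  | union {L₁ L₂} : IsParallelRational L₁ → IsParallelRational L₂ → IsParallelRational (L₁ ∪ L₂)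
  | seq {L₁ L₂} : IsParallelRational L₁ → IsParallelRational L₂ →
      IsParallelRational (seqLang L₁ L₂)
  | par {L₁ L₂} : IsParallelRational L₁ → IsParallelRational L₂ →
      IsParallelRational (parLang L₁ L₂)
  | parStar {L} : IsParallelRational L → IsParallelRational (parStar L)

/-- A parallel regular language: a language of parallel words denoted by a parallel regular
expression. -/
def IsParallelRegular (L : Set (ParWord α)) : Prop := IsParallelRational (ParWord.toSP '' L)

end RegularLanguages

/-- Context free parallel grammars `(V, T, P, S)` with terminal alphabet `T = α`: finitely many
variables and finitely many productions `A → β` with `β ∈ (V ∪ T)^⊕`. -/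
structure ParallelGrammar (α : Type u) where
  Var : Type
  finite_var : Finite Var
  prods : Set (Var × ParWord (Var ⊕ α))
  finite_prods : prods.Finite
  start : Var

namespace ParallelGrammar

variable {α : Type u}

/-- One derivation step: `A ‖ γ ⇒ β ‖ γ` for a production `A → β`. -/
def Step (G : ParallelGrammar α) (u v : ParWord (G.Var ⊕ α)) : Prop :=
  ∃ (A : G.Var) (β γ : ParWord (G.Var ⊕ α)),
    (A, β) ∈ G.prods ∧ u = {Sum.inl A} + γ ∧ v = β + γ

/-- `L(G)`: the words over the terminals that are derivable from the start symbol. -/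
def language (G : ParallelGrammar α) : Set (ParWord α) :=
  {w | Relation.ReflTransGen G.Step {Sum.inl G.start} (w.map Sum.inr)}

/-- A grammar is linear (parallel regular) if every production has the form `A → x ‖ B` (which is
the same as `A → B ‖ x`) or `A → x`, with `B` a variable and `x` a parallel word of terminals. -/
def IsLinear (G : ParallelGrammar α) : Prop :=
  ∀ (A : G.Var) (β : ParWord (G.Var ⊕ α)), (A, β) ∈ G.prods →
    (∃ (x : ParWord α) (B : G.Var), β = x.map Sum.inr + {Sum.inl B}) ∨
      ∃ x : ParWord α, β = x.map Sum.inr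

end ParallelGrammar

/-- Finite branching automata over `α`, with sequential transitions `(p, a, q)`, fork transitions
`(p, M)`, join transitions `(N, q)`, where `M` and `N` are multisets of at least two states, and
parallel transitions `((p, M), w, (N, q))` made of a fork, a parallel word and a join. -/
structure BranchingAutomaton (α : Type u) where
  State : Type
  finite_state : Finite State
  seqTrans : Set (State × α × State)
  forkTrans : Set (State × Multiset State)
  joinTrans : Set (Multiset State × State)
  parTrans : Set ((State × Multiset State) × ParWord α × (Multiset State × State))
  finite_seq : seqTrans.Finite
  finite_fork : forkTrans.Finite
  finite_join : joinTrans.Finite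
  finite_par : parTrans.Finite
  two_le_card_fork : ∀ t ∈ forkTrans, 2 ≤ Multiset.card t.2
  two_le_card_join : ∀ t ∈ joinTrans, 2 ≤ Multiset.card t.1
  par_subset : ∀ t ∈ parTrans, t.1 ∈ forkTrans ∧ t.2.2 ∈ joinTrans
  start : Set State
  final : Set State

namespace BranchingAutomaton

variable {α : Type u}

/-- `A.Run p x q`: there is a run of `A` from `p` to `q` labelled `x`. In the rule `fork`, the list
`l` holds the branches `(pᵢ, xᵢ, qᵢ)`: the automaton forks from `p` into the multiset of the `pᵢ`,
runs from `pᵢ` to `qᵢ` on `xᵢ` for every `i`, and joins the multiset of the `qᵢ` into `q`; the label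
is the parallel composition of the `xᵢ`. -/
inductive Run (A : BranchingAutomaton α) : A.State → SPWord α → A.State → Prop
  | empty (p : A.State) : Run A p SPWord.empty p
  | letter {p q : A.State} {a : α} : (p, a, q) ∈ A.seqTrans → Run A p (SPWord.letter a) q
  | seq {p q r : A.State} {x y : SPWord α} :
      Run A p x q → Run A q y r → Run A p (SPWord.seq x y) r
  | fork {p q : A.State} (l : List (A.State × SPWord α × A.State)) :
      (p, (l.map (fun t => t.1) : Multiset A.State)) ∈ A.forkTrans →
      ((l.map (fun t => t.2.2) : Multiset A.State), q) ∈ A.joinTrans →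
      (∀ t ∈ l, Run A t.1 t.2.1 t.2.2) →
      Run A p ((l.map (fun t => t.2.1)).foldr SPWord.par SPWord.empty) q
  | par {p q : A.State} {M N : Multiset A.State} {w : ParWord α} :
      ((p, M), w, (N, q)) ∈ A.parTrans → Run A p w.toSP q

/-- The set of series-parallel words labelling a run from a start state to a final state. -/
def language (A : BranchingAutomaton α) : Set (SPWord α) :=
  {x | ∃ p ∈ A.start, ∃ q ∈ A.final, A.Run p x q}

end BranchingAutomaton

/-! All four conditions are compared with one notion: `L`, a set of multisets, is semilinear.
Semilinear sets are the rational subsets of a commutative monoid, so they are parallel regular by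
definition (`IsSemilinearSet.isParallelRegular`). Conversely, a sequential product meets the
parallel words only where one factor is empty, so the parallel words of a rational language are
semilinear (`IsParallelRational.isSemilinearSet_preimage`). A finite union of sets `v + closure F`
is generated by a linear grammar that emits `v` and then loops on `F`
(`IsSemilinearSet.exists_linear_grammar`). A linear grammar is simulated by an automaton that forks
for `A → x ‖ B` into a branch for `B` and a branch for `x` (`IsLinear.exists_automaton`). To return
from automata, the parallel words labelling runs from `p` to `q` are derived from a variable `(p,
q)`. Forks produce several variables at once, so this grammar is context free but not linear, and
Parikh's theorem is needed (`isSemilinearSet_languageFrom`). It is proved by Gaussian elimination: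
commutativity gives each single equation `X = S` a semilinear solution in closed form
(`solveLetter`). -/

open Pointwise

/-! ### Semilinear sets as the rational sets of a commutative monoid. -/

section Semilinear

theorem IsSemilinearSet.induction {M : Type*} [AddCommMonoid M] {p : Set M → Prop}
    (empty : p ∅) (singleton : ∀ a, p {a})
    (union : ∀ s t, p s → p t → p (s ∪ t)) (add : ∀ s t, p s → p t → p (s + t))
    (closure : ∀ s, p s → p (AddSubmonoid.closure s : Set M))
    {s : Set M} (hs : IsSemilinearSet s) : p s := by
  have of_finite : ∀ t : Set M, t.Finite → p t := by
    intro t ht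
    induction t, ht using Set.Finite.induction_on with
    | empty => exact empty
    | insert _ _ ih => exact union _ _ (singleton _) ih
  obtain ⟨S, hS, hlin, rfl⟩ := hs
  induction S, hS using Set.Finite.induction_on with
  | empty => simpa using empty
  | insert _ _ ih =>
    rw [Set.sUnion_insert]
    refine union _ _ ?_ (ih fun t ht => hlin t (Set.mem_insert_of_mem _ ht))
    obtain ⟨a, t, ht, rfl⟩ := hlin _ (Set.mem_insert _ _)
    rw [← Set.singleton_vadd]
    exact add _ _ (singleton _) (closure _ (of_finite t ht))

end Semilinear

/-! ### Substitution of languages for letters. -/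

section Substitution

variable {γ δ ε : Type*}

/-- The words obtained from `m` by replacing every letter `c` by a word of `σ c`. -/
def substWord (σ : γ → Set (Multiset δ)) (m : Multiset γ) : Set (Multiset δ) := (m.map σ).sum

/-- The words obtained from words of `S` by replacing every letter `c` by a word of `σ c`. -/
def substLang (σ : γ → Set (Multiset δ)) (S : Set (Multiset γ)) : Set (Multiset δ) :=
  ⋃ m ∈ S, substWord σ m

theorem mem_substLang {σ : γ → Set (Multiset δ)} {S : Set (Multiset γ)} {x : Multiset δ} :
    x ∈ substLang σ S ↔ ∃ m ∈ S, x ∈ substWord σ m := by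
  simp [substLang]

@[simp] theorem substWord_zero (σ : γ → Set (Multiset δ)) : substWord σ 0 = {0} := rfl

@[simp] theorem substWord_cons (σ : γ → Set (Multiset δ)) (c : γ) (m : Multiset γ) :
    substWord σ (c ::ₘ m) = σ c + substWord σ m := by
  simp [substWord]

@[simp] theorem substWord_singleton (σ : γ → Set (Multiset δ)) (c : γ) :
    substWord σ {c} = σ c := by
  simp [substWord]

@[simp] theorem substWord_add (σ : γ → Set (Multiset δ)) (m n : Multiset γ) :
    substWord σ (m + n) = substWord σ m + substWord σ n := by
  simp [substWord]

theorem substWord_mono {σ τ : γ → Set (Multiset δ)} (h : ∀ c, σ c ⊆ τ c) (m : Multiset γ) :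
    substWord σ m ⊆ substWord τ m := by
  induction m using Multiset.induction_on with
  | empty => exact subset_rfl
  | cons c m ih => simpa using Set.add_subset_add (h c) ih

theorem substWord_eq_singleton {σ : γ → Set (Multiset γ)} {m : Multiset γ}
    (h : ∀ c ∈ m, σ c = {{c}}) : substWord σ m = {m} := by
  induction m using Multiset.induction_on with
  | empty => simp
  | cons c m ih =>
    rw [substWord_cons, ih fun d hd => h d (Multiset.mem_cons_of_mem hd),
      h c (Multiset.mem_cons_self c m), Set.singleton_add_singleton, Multiset.singleton_add]

theorem exists_mem_of_mem_substWord {σ : γ → Set (Multiset δ)} {m : Multiset γ}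
    {x : Multiset δ} (hx : x ∈ substWord σ m) {d : δ} (hd : d ∈ x) :
    ∃ c ∈ m, ∃ y ∈ σ c, d ∈ y := by
  induction m using Multiset.induction_on generalizing x with
  | empty => simp_all
  | cons c m ih =>
    rw [substWord_cons] at hx
    obtain ⟨y, hy, z, hz, rfl⟩ := hx
    rcases Multiset.mem_add.1 hd with h | h
    · exact ⟨c, Multiset.mem_cons_self c m, y, hy, h⟩
    · obtain ⟨c', hc', r⟩ := ih hz h
      exact ⟨c', Multiset.mem_cons_of_mem hc', r⟩

@[simp] theorem substLang_empty (σ : γ → Set (Multiset δ)) : substLang σ ∅ = ∅ := by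
  simp [substLang]

@[simp] theorem substLang_singleton (σ : γ → Set (Multiset δ)) (m : Multiset γ) :
    substLang σ {m} = substWord σ m := by
  simp [substLang]

theorem substLang_union (σ : γ → Set (Multiset δ)) (S T : Set (Multiset γ)) :
    substLang σ (S ∪ T) = substLang σ S ∪ substLang σ T := by
  exact Set.biUnion_union S T _

theorem substLang_add (σ : γ → Set (Multiset δ)) (S T : Set (Multiset γ)) :
    substLang σ (S + T) = substLang σ S + substLang σ T := by
  ext x
  simp only [mem_substLang, Set.mem_add]
  constructor
  · rintro ⟨_, ⟨m, hm, n, hn, rfl⟩, hx⟩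
    rw [substWord_add] at hx
    obtain ⟨y, hy, z, hz, rfl⟩ := hx
    exact ⟨y, ⟨m, hm, hy⟩, z, ⟨n, hn, hz⟩, rfl⟩
  · rintro ⟨y, ⟨m, hm, hy⟩, z, ⟨n, hn, hz⟩, rfl⟩
    exact ⟨m + n, ⟨m, hm, n, hn, rfl⟩, by rw [substWord_add]; exact Set.add_mem_add hy hz⟩

theorem substLang_closure (σ : γ → Set (Multiset δ)) (S : Set (Multiset γ)) :
    substLang σ (AddSubmonoid.closure S) = AddSubmonoid.closure (substLang σ S) := by
  ext x
  constructor
  · rw [mem_substLang]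
    rintro ⟨m, hm, hx⟩
    induction hm using AddSubmonoid.closure_induction generalizing x with
    | mem m hm => exact AddSubmonoid.subset_closure (mem_substLang.2 ⟨m, hm, hx⟩)
    | zero =>
      rw [substWord_zero, Set.mem_singleton_iff] at hx
      exact hx ▸ zero_mem _
    | add m n _ _ ihm ihn =>
      rw [substWord_add] at hx
      obtain ⟨y, hy, z, hz, rfl⟩ := hx
      exact add_mem (ihm _ hy) (ihn _ hz)
  · intro hx
    induction hx using AddSubmonoid.closure_induction with
    | mem x hx =>
      obtain ⟨m, hm, hx⟩ := mem_substLang.1 hx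
      exact mem_substLang.2 ⟨m, AddSubmonoid.subset_closure hm, hx⟩
    | zero => exact mem_substLang.2 ⟨0, zero_mem _, by simp⟩
    | add x y _ _ ihx ihy =>
      obtain ⟨m, hm, hx⟩ := mem_substLang.1 ihx
      obtain ⟨n, hn, hy⟩ := mem_substLang.1 ihy
      exact mem_substLang.2 ⟨m + n, add_mem hm hn, by
        rw [substWord_add]; exact Set.add_mem_add hx hy⟩

theorem substLang_substWord (τ : δ → Set (Multiset ε)) (σ : γ → Set (Multiset δ))
    (m : Multiset γ) :
    substLang τ (substWord σ m) = substWord (fun c => substLang τ (σ c)) m := by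
  induction m using Multiset.induction_on with
  | empty => simp
  | cons c m ih => rw [substWord_cons, substLang_add, ih, substWord_cons]

theorem substLang_substLang (τ : δ → Set (Multiset ε)) (σ : γ → Set (Multiset δ))
    (S : Set (Multiset γ)) :
    substLang τ (substLang σ S) = substLang (fun c => substLang τ (σ c)) S := by
  ext x
  rw [mem_substLang, mem_substLang]
  constructor
  · rintro ⟨n, hn, hx⟩
    obtain ⟨m, hm, hn⟩ := mem_substLang.1 hn
    exact ⟨m, hm, by rw [← substLang_substWord]; exact mem_substLang.2 ⟨n, hn, hx⟩⟩
  · rintro ⟨m, hm, hx⟩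
    rw [← substLang_substWord] at hx
    obtain ⟨n, hn, hx⟩ := mem_substLang.1 hx
    exact ⟨n, mem_substLang.2 ⟨m, hm, hn⟩, hx⟩

theorem IsSemilinearSet.substWord {σ : γ → Set (Multiset δ)}
    (hσ : ∀ c, IsSemilinearSet (σ c)) (m : Multiset γ) : IsSemilinearSet (substWord σ m) := by
  induction m using Multiset.induction_on with
  | empty => simp
  | cons c m ih => rw [substWord_cons]; exact (hσ c).add ih

/-- Substitution commutes with unions, sums and generated submonoids, so the induction on rational
operations passes through it. -/
theorem IsSemilinearSet.substLang {σ : γ → Set (Multiset δ)}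
    (hσ : ∀ c, IsSemilinearSet (σ c)) {S : Set (Multiset γ)} (hS : IsSemilinearSet S) :
    IsSemilinearSet (substLang σ S) := by
  refine hS.induction (p := fun S => IsSemilinearSet (_root_.substLang σ S)) (by simp)
    (fun a => ?_) (fun s t hs ht => ?_) (fun s t hs ht => ?_) (fun s hs => ?_)
  · rw [substLang_singleton]; exact .substWord hσ a
  · rw [substLang_union]; exact hs.union ht
  · rw [substLang_add]; exact hs.add ht
  · rw [substLang_closure]; exact hs.closure

end Substitution

/-! ### Solving one equation, then a system, over commutative words. -/

section OneVariable

variable {γ : Type*}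

/-- The words obtained from words of `S` by deleting one occurrence of the letter `X`. -/
def deleteOne (X : γ) (S : Set (Multiset γ)) : Set (Multiset γ) := {d | X ::ₘ d ∈ S}

/-- Leibniz rule: the deleted occurrence of `X` lies in one of the two summands. -/
theorem deleteOne_add (X : γ) (S T : Set (Multiset γ)) :
    deleteOne X (S + T) = (deleteOne X S + T) ∪ (S + deleteOne X T) := by
  ext d
  simp only [deleteOne, Set.mem_union, Set.mem_add, Set.mem_ofPred_eq]
  constructor
  · rintro ⟨m, hm, n, hn, h⟩
    have hX : X ∈ m + n := h ▸ Multiset.mem_cons_self X d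
    rcases Multiset.mem_add.1 hX with hX | hX
    · obtain ⟨m, rfl⟩ := Multiset.exists_cons_of_mem hX
      rw [Multiset.cons_add, Multiset.cons_inj_right] at h
      exact .inl ⟨m, hm, n, hn, h⟩
    · obtain ⟨n, rfl⟩ := Multiset.exists_cons_of_mem hX
      rw [Multiset.add_cons, Multiset.cons_inj_right] at h
      exact .inr ⟨m, hm, n, hn, h⟩
  · rintro (⟨m, hm, n, hn, rfl⟩ | ⟨m, hm, n, hn, rfl⟩)
    · exact ⟨_, hm, _, hn, Multiset.cons_add _ _ _⟩
    · exact ⟨_, hm, _, hn, Multiset.add_cons _ _ _⟩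

/-- The deleted `X` lies in one generator of the sum; by commutativity that generator can be moved
to the front. -/
theorem deleteOne_closure (X : γ) (S : Set (Multiset γ)) :
    deleteOne X (AddSubmonoid.closure S) = deleteOne X S + AddSubmonoid.closure S := by
  ext d
  constructor
  · intro hd
    obtain ⟨e, he⟩ : ∃ e, e = X ::ₘ d := ⟨_, rfl⟩
    change X ::ₘ d ∈ AddSubmonoid.closure S at hd
    rw [← he] at hd
    induction hd using AddSubmonoid.closure_induction_left generalizing d with
    | zero => exact absurd he (Multiset.zero_ne_cons)
    | add_left m hm n hn ih =>
      have hX : X ∈ m + n := he ▸ Multiset.mem_cons_self X d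
      rcases Multiset.mem_add.1 hX with hX | hX
      · obtain ⟨m, rfl⟩ := Multiset.exists_cons_of_mem hX
        rw [Multiset.cons_add, Multiset.cons_inj_right] at he
        exact ⟨m, hm, n, hn, he⟩
      · obtain ⟨n, rfl⟩ := Multiset.exists_cons_of_mem hX
        rw [Multiset.add_cons, Multiset.cons_inj_right] at he
        obtain ⟨y, hy, z, hz, rfl⟩ := ih n rfl
        exact ⟨y, hy, m + z, add_mem (AddSubmonoid.subset_closure hm) hz,
          by rw [← he]; exact add_left_comm y m z⟩
  · rintro ⟨m, hm, n, hn, rfl⟩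
    change X ::ₘ (m + n) ∈ AddSubmonoid.closure S
    rw [← Multiset.cons_add]
    exact add_mem (AddSubmonoid.subset_closure hm) hn

theorem IsSemilinearSet.deleteOne (X : γ) {S : Set (Multiset γ)} (hS : IsSemilinearSet S) :
    IsSemilinearSet (deleteOne X S) := by
  refine (hS.induction (p := fun S => IsSemilinearSet S ∧ IsSemilinearSet (_root_.deleteOne X S))
    ⟨.empty, .empty⟩ (fun a => ⟨.singleton a, .of_finite ?_⟩)
    (fun s t hs ht => ⟨hs.1.union ht.1, hs.2.union ht.2⟩) (fun s t hs ht => ⟨hs.1.add ht.1, ?_⟩)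
    (fun s hs => ⟨hs.1.closure, ?_⟩)).2
  · refine Set.Subsingleton.finite fun d hd e he => ?_
    exact (Multiset.cons_inj_right X).1
      ((Set.mem_singleton_iff.1 hd).trans (Set.mem_singleton_iff.1 he).symm)
  · rw [deleteOne_add]
    exact (hs.2.add ht.1).union (hs.1.add ht.2)
  · rw [deleteOne_closure]
    exact hs.2.add hs.1.closure

variable [DecidableEq γ]

/-- The substitution that replaces the letter `X` by words of `T` and keeps all other letters. -/
def replaceLetter (X : γ) (T : Set (Multiset γ)) : γ → Set (Multiset γ) :=
  Function.update (fun c => {{c}}) X T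

@[simp] theorem replaceLetter_self (X : γ) (T : Set (Multiset γ)) : replaceLetter X T X = T := by
  simp [replaceLetter]

theorem replaceLetter_of_ne {X c : γ} (h : c ≠ X) (T : Set (Multiset γ)) :
    replaceLetter X T c = {{c}} := by
  simp [replaceLetter, h]

theorem substWord_replaceLetter_of_notMem {X : γ} {m : Multiset γ} (h : X ∉ m)
    (T : Set (Multiset γ)) : substWord (replaceLetter X T) m = {m} :=
  substWord_eq_singleton fun c hc => replaceLetter_of_ne (by rintro rfl; exact h hc) T

theorem IsSemilinearSet.replaceLetter (X : γ) {T : Set (Multiset γ)} (hT : IsSemilinearSet T)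
    (c : γ) : IsSemilinearSet (replaceLetter X T c) := by
  by_cases h : c = X
  · subst h; simpa
  · rw [replaceLetter_of_ne h]; exact .singleton _

/-- The words of `S` in which `X` does not occur. -/
def avoiding (X : γ) (S : Set (Multiset γ)) : Set (Multiset γ) := {m ∈ S | X ∉ m}

/-- Replacing `X` by `∅` annihilates exactly the words that contain `X`. Hence semilinearity of
`avoiding X S` is a case of substitution. -/
theorem substLang_replaceLetter_empty (X : γ) (S : Set (Multiset γ)) :
    substLang (replaceLetter X ∅) S = avoiding X S := by
  ext x
  rw [mem_substLang]
  constructor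
  · rintro ⟨m, hm, hx⟩
    by_cases hX : X ∈ m
    · obtain ⟨m, rfl⟩ := Multiset.exists_cons_of_mem hX
      simp at hx
    · rw [substWord_replaceLetter_of_notMem hX, Set.mem_singleton_iff] at hx
      exact hx ▸ ⟨hm, hX⟩
  · rintro ⟨hm, hX⟩
    exact ⟨x, hm, by rw [substWord_replaceLetter_of_notMem hX]; rfl⟩

theorem IsSemilinearSet.avoiding (X : γ) {S : Set (Multiset γ)} (hS : IsSemilinearSet S) :
    IsSemilinearSet (avoiding X S) := by
  rw [← substLang_replaceLetter_empty]
  exact .substLang (.replaceLetter X .empty) hS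

/-- The increments by which a word derived from `X` grows when `X → S` is unfolded at one
occurrence of `X` and all others are replaced by words without `X`. -/
def increments (X : γ) (S : Set (Multiset γ)) : Set (Multiset γ) :=
  substLang (replaceLetter X (avoiding X S)) (deleteOne X S)

/-- The least solution of the equation `X = S`, where `X` may occur in words of `S`. -/
def solveLetter (X : γ) (S : Set (Multiset γ)) : Set (Multiset γ) :=
  avoiding X S + AddSubmonoid.closure (increments X S)

theorem IsSemilinearSet.solveLetter (X : γ) {S : Set (Multiset γ)} (hS : IsSemilinearSet S) :
    IsSemilinearSet (solveLetter X S) :=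
  (hS.avoiding X).add (IsSemilinearSet.closure
    (.substLang (.replaceLetter X (hS.avoiding X)) (hS.deleteOne X)))

/-- The contributions from `C` of all occurrences of `X` can be pulled out and merged into one
element of `C`. This is the point where commutativity allows nested unfoldings to be rearranged into
a single chain. -/
theorem exists_add_of_mem_substWord_replaceLetter {X : γ} {T : Set (Multiset γ)}
    {C : AddSubmonoid (Multiset γ)} {m x : Multiset γ}
    (hx : x ∈ substWord (replaceLetter X (T + C)) m) :
    ∃ y ∈ substWord (replaceLetter X T) m, ∃ c ∈ C, y + c = x := by
  induction m using Multiset.induction_on generalizing x with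
  | empty => exact ⟨x, hx, 0, zero_mem C, add_zero x⟩
  | cons a m ih =>
    rw [substWord_cons] at hx
    obtain ⟨u, hu, v, hv, rfl⟩ := hx
    obtain ⟨y, hy, c, hc, rfl⟩ := ih hv
    rw [substWord_cons]
    by_cases h : a = X
    · subst h
      rw [replaceLetter_self] at hu ⊢
      obtain ⟨t, ht, e, he, rfl⟩ := hu
      exact ⟨t + y, Set.add_mem_add ht hy, e + c, add_mem he hc, add_add_add_comm t y e c⟩
    · rw [replaceLetter_of_ne h] at hu ⊢
      exact ⟨u + y, Set.add_mem_add hu hy, c, hc, add_assoc u y c⟩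

/-- If `m = X + d`, the chosen `X` contributes a word of the solution, while `d` contributes one
increment plus further elements of the closure. Conversely, an increment `g` obtained from `d` is
added to `r + c` by unfolding `X` to `X + d` and putting `r + c` at the chosen occurrence. Only the
fixed point property is proved here; minimality enters through `Derives.of_mem_solveLetter`. -/
theorem substLang_replaceLetter_solveLetter (X : γ) (S : Set (Multiset γ)) :
    substLang (replaceLetter X (solveLetter X S)) S = solveLetter X S := by
  ext x
  rw [mem_substLang]
  constructor
  · rintro ⟨m, hm, hx⟩
    by_cases hX : X ∈ m
    · obtain ⟨d, rfl⟩ := Multiset.exists_cons_of_mem hX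
      rw [substWord_cons, replaceLetter_self] at hx
      obtain ⟨_, ⟨t, ht, e, he, rfl⟩, z, hz, rfl⟩ := hx
      obtain ⟨y, hy, c, hc, rfl⟩ := exists_add_of_mem_substWord_replaceLetter hz
      refine ⟨t, ht, e + (y + c), add_mem he (add_mem ?_ hc), (add_assoc t e (y + c)).symm⟩
      exact AddSubmonoid.subset_closure (mem_substLang.2 ⟨d, hm, hy⟩)
    · rw [substWord_replaceLetter_of_notMem hX, Set.mem_singleton_iff] at hx
      exact ⟨x, hx ▸ ⟨hm, hX⟩, 0, zero_mem _, add_zero x⟩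
  · rintro ⟨r, hr, c, hc, rfl⟩
    induction hc using AddSubmonoid.closure_induction_left with
    | zero => exact ⟨r, hr.1, by simp [substWord_replaceLetter_of_notMem hr.2]⟩
    | add_left g hg c hc _ =>
      obtain ⟨d, hd, hg⟩ := mem_substLang.1 hg
      refine ⟨X ::ₘ d, hd, ?_⟩
      have hg' : g ∈ substWord (replaceLetter X (solveLetter X S)) d := by
        refine substWord_mono (fun a u hu => ?_) d hg
        by_cases h : a = X
        · subst h
          rw [replaceLetter_self] at hu ⊢
          exact ⟨u, hu, 0, zero_mem _, add_zero u⟩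
        · rwa [replaceLetter_of_ne h] at hu ⊢
      rw [substWord_cons, replaceLetter_self]
      exact ⟨r + c, ⟨r, hr, c, hc, rfl⟩, g, hg', by
        change r + c + g = r + (g + c); rw [add_comm g c, add_assoc]⟩

/-- Eliminates the letters of a list, one after the other, from the system of equations
`c = P c`. -/
def eliminate (P : γ → Set (Multiset γ)) : List γ → γ → Set (Multiset γ)
  | [], c => P c
  | X :: l, c => substLang (replaceLetter X (solveLetter X (eliminate P l X))) (eliminate P l c)

variable {P : γ → Set (Multiset γ)}

theorem IsSemilinearSet.eliminate (hP : ∀ c, IsSemilinearSet (P c)) (l : List γ) (c : γ) :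
    IsSemilinearSet (eliminate P l c) := by
  induction l generalizing c with
  | nil => exact hP c
  | cons X l ih => exact .substLang (.replaceLetter X ((ih X).solveLetter X)) (ih c)

/-- Solving for `X` removes `X` and introduces no letter foreign to `S`, so letters eliminated
earlier do not come back. -/
theorem notMem_solveLetter {X c : γ} {S : Set (Multiset γ)} (hc : c = X ∨ ∀ m ∈ S, c ∉ m)
    {x : Multiset γ} (hx : x ∈ solveLetter X S) : c ∉ x := by
  have havoid : ∀ m ∈ avoiding X S, c ∉ m := fun m hm => hc.elim (· ▸ hm.2) fun h => h m hm.1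
  obtain ⟨r, hr, y, hy, rfl⟩ := hx
  simp only [Multiset.mem_add, not_or]
  refine ⟨havoid r hr, ?_⟩
  induction hy using AddSubmonoid.closure_induction with
  | zero => simp
  | add y z _ _ ihy ihz => simp [ihy, ihz]
  | mem y hy =>
    obtain ⟨d, hd, hy⟩ := mem_substLang.1 hy
    intro hcy
    obtain ⟨a, ha, z, hz, hcz⟩ := exists_mem_of_mem_substWord hy hcy
    by_cases h : a = X
    · subst h
      rw [replaceLetter_self] at hz
      exact havoid z hz hcz
    · rw [replaceLetter_of_ne h, Set.mem_singleton_iff] at hz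
      subst hz
      rw [Multiset.mem_singleton] at hcz
      subst hcz
      rcases hc with hc | hc
      · exact h hc
      · exact hc _ hd (Multiset.mem_cons_of_mem ha)

theorem notMem_of_mem_eliminate {l : List γ} {c X : γ} (hX : X ∈ l) {m : Multiset γ}
    (hm : m ∈ eliminate P l c) : X ∉ m := by
  induction l generalizing c m with
  | nil => simp at hX
  | cons Y l ih =>
    obtain ⟨n, hn, hm⟩ := mem_substLang.1 hm
    intro hXm
    obtain ⟨a, ha, z, hz, hXz⟩ := exists_mem_of_mem_substWord hm hXm
    by_cases h : a = Y
    · subst h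
      rw [replaceLetter_self] at hz
      exact notMem_solveLetter ((List.mem_cons.1 hX).imp_right fun h _ => ih h) hz hXz
    · rw [replaceLetter_of_ne h, Set.mem_singleton_iff] at hz
      subst hz
      rw [Multiset.mem_singleton] at hXz
      subst hXz
      exact ih ((List.mem_cons.1 hX).resolve_left h) hn ha

theorem eliminate_of_notMem {l : List γ} {c : γ} (hc : c ∉ l) (hP : P c = {{c}}) :
    eliminate P l c = {{c}} := by
  induction l with
  | nil => exact hP
  | cons X l ih =>
    rw [List.mem_cons, not_or] at hc
    rw [eliminate, ih hc.2, substLang_singleton, substWord_singleton, replaceLetter_of_ne hc.1]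

/-- Back substitution: a solution of the system with `X` eliminated also solves the system before
that elimination. At `X` the hypothesis and the fixed point property say that `N X` is the value of
`solveLetter X _` under `N`, so inserting this expression for `X` before evaluating by `N` changes
nothing. -/
theorem substLang_eliminate_of_cons {N : γ → Set (Multiset γ)} {X : γ} {l : List γ}
    (h : ∀ c, substLang N (eliminate P (X :: l) c) = N c) (c : γ) :
    substLang N (eliminate P l c) = N c := by
  have key : N = fun a => substLang N (replaceLetter X (solveLetter X (eliminate P l X)) a) := by
    funext a
    by_cases ha : a = X
    · subst ha
      conv_lhs => rw [← h a, eliminate, substLang_replaceLetter_solveLetter]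
      rw [replaceLetter_self]
    · rw [replaceLetter_of_ne ha, substLang_singleton, substWord_singleton]
  conv_rhs => rw [← h c, eliminate, substLang_substLang, ← key]

/-- Eliminating all letters that occur on a left-hand side solves the system `c = P c`. -/
theorem substLang_eliminate {l : List γ} (hP : ∀ c ∉ l, P c = {{c}}) (c : γ) :
    substLang (eliminate P l) (P c) = eliminate P l c := by
  -- Fully eliminated words contain only letters outside `l`, which the substitution fixes.
  have base : ∀ c, substLang (eliminate P l) (eliminate P l c) = eliminate P l c := by
    intro c
    ext x
    rw [mem_substLang]
    have : ∀ m ∈ eliminate P l c, substWord (eliminate P l) m = {m} := fun m hm =>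
      substWord_eq_singleton fun d hd =>
        have hdl : d ∉ l := fun h => notMem_of_mem_eliminate h hm hd
        eliminate_of_notMem hdl (hP d hdl)
    constructor
    · rintro ⟨m, hm, hx⟩
      rw [this m hm, Set.mem_singleton_iff] at hx
      exact hx ▸ hm
    · intro hx
      exact ⟨x, hx, by rw [this x hx]; rfl⟩
  -- Undo the eliminations one by one; for the empty list the system is `P` itself.
  have descend : ∀ l' : List γ,
      (∀ c, substLang (eliminate P l) (eliminate P l' c) = eliminate P l c) →
      ∀ c, substLang (eliminate P l) (P c) = eliminate P l c := by
    intro l'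
    induction l' with
    | nil => exact fun h => h
    | cons X l' ih => exact fun h => ih (substLang_eliminate_of_cons h)
  exact descend l base c

end OneVariable

/-! ### Evaluating sentential forms, with variables interpreted as languages. -/

section Terminals

variable {V α : Type*}

theorem substWord_map_inr (N : V → Set (Multiset α)) (w : Multiset α) :
    substWord (Sum.elim N fun a => {{a}}) (w.map Sum.inr) = {w} := by
  induction w using Multiset.induction_on with
  | empty => simp
  | cons a w ih =>
    rw [Multiset.map_cons, substWord_cons, ih, Sum.elim_inr, Set.singleton_add_singleton,
      Multiset.singleton_add]

theorem eq_map_inr_of_mem_substWord {m : Multiset (V ⊕ α)} {w : Multiset α}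
    (hw : w ∈ substWord (Sum.elim (fun _ => ∅) fun a => {{a}}) m) : m = w.map Sum.inr := by
  induction m using Multiset.induction_on generalizing w with
  | empty => simp_all
  | cons c m ih =>
    rw [substWord_cons] at hw
    obtain ⟨y, hy, z, hz, rfl⟩ := hw
    rcases c with B | a
    · simp at hy
    · rw [Sum.elim_inr, Set.mem_singleton_iff] at hy
      change _ = (y + z).map Sum.inr
      rw [ih hz, hy, Multiset.singleton_add, Multiset.map_cons]

theorem map_inr_mem_substWord {N : V → Set (Multiset α)} {σ : V ⊕ α → Set (Multiset (V ⊕ α))}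
    (hN : ∀ B, ∀ y ∈ N B, y.map Sum.inr ∈ σ (Sum.inl B)) (hσ : ∀ a, σ (Sum.inr a) = {{Sum.inr a}})
    {m : Multiset (V ⊕ α)} {w : Multiset α} (hw : w ∈ substWord (Sum.elim N fun a => {{a}}) m) :
    w.map Sum.inr ∈ substWord σ m := by
  induction m using Multiset.induction_on generalizing w with
  | empty => simp_all
  | cons c m ih =>
    rw [substWord_cons] at hw ⊢
    obtain ⟨y, hy, z, hz, rfl⟩ := hw
    change (y + z).map Sum.inr ∈ _
    rw [Multiset.map_add]
    refine Set.add_mem_add ?_ (ih hz)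
    rcases c with B | a
    · exact hN B y hy
    · rw [Sum.elim_inr, Set.mem_singleton_iff] at hy
      simp [hy, hσ]

end Terminals

/-! ### Derivations and Parikh's theorem. -/

namespace ParallelGrammar

variable {α : Type*} {G : ParallelGrammar α}

/-- Derivability between sentential forms. -/
def Derives (G : ParallelGrammar α) : ParWord (G.Var ⊕ α) → ParWord (G.Var ⊕ α) → Prop :=
  Relation.ReflTransGen G.Step

/-- The words over the terminals that are derivable from the variable `A`. -/
def languageFrom (G : ParallelGrammar α) (A : G.Var) : Set (ParWord α) :=
  {w | G.Derives {Sum.inl A} (w.map Sum.inr)}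

theorem Derives.refl (u : ParWord (G.Var ⊕ α)) : G.Derives u u := Relation.ReflTransGen.refl

theorem Derives.trans {u v w : ParWord (G.Var ⊕ α)} (h : G.Derives u v) (h' : G.Derives v w) :
    G.Derives u w := Relation.ReflTransGen.trans h h'

theorem Derives.of_mem_prods {A : G.Var} {β : ParWord (G.Var ⊕ α)} (h : (A, β) ∈ G.prods) :
    G.Derives {Sum.inl A} β :=
  .single ⟨A, β, 0, h, (add_zero _).symm, (add_zero _).symm⟩

theorem Derives.add_right {u v : ParWord (G.Var ⊕ α)} (h : G.Derives u v)
    (m : ParWord (G.Var ⊕ α)) : G.Derives (u + m) (v + m) := by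
  refine Relation.ReflTransGen.lift (r := G.Step) (· + m) ?_ u v h
  rintro _ _ ⟨A, β, δ, hA, rfl, rfl⟩
  exact ⟨A, β, δ + m, hA, add_assoc _ _ _, add_assoc _ _ _⟩

theorem Derives.add {u v u' v' : ParWord (G.Var ⊕ α)} (h : G.Derives u v)
    (h' : G.Derives u' v') : G.Derives (u + u') (v + v') := by
  refine (h.add_right u').trans ?_
  rw [add_comm v, add_comm v]
  exact h'.add_right v

theorem Derives.of_mem_substWord {σ : G.Var ⊕ α → Set (ParWord (G.Var ⊕ α))}
    (hσ : ∀ c, ∀ y ∈ σ c, G.Derives {c} y) {m x : ParWord (G.Var ⊕ α)}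
    (hx : x ∈ substWord σ m) : G.Derives m x := by
  induction m using Multiset.induction_on generalizing x with
  | empty =>
    rw [substWord_zero, Set.mem_singleton_iff] at hx
    exact hx ▸ .refl _
  | cons c m ih =>
    rw [substWord_cons] at hx
    obtain ⟨y, hy, z, hz, rfl⟩ := hx
    rw [← Multiset.singleton_add]
    exact (hσ c y hy).add (ih hz)

section Elimination

variable [DecidableEq (G.Var ⊕ α)]

theorem Derives.of_mem_substWord_replaceLetter {X : G.Var ⊕ α} {T : Set (ParWord (G.Var ⊕ α))}
    (hT : ∀ y ∈ T, G.Derives {X} y) {m x : ParWord (G.Var ⊕ α)}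
    (hx : x ∈ substWord (replaceLetter X T) m) : G.Derives m x := by
  refine .of_mem_substWord (fun c y hy => ?_) hx
  by_cases h : c = X
  · subst h
    rw [replaceLetter_self] at hy
    exact hT y hy
  · rw [replaceLetter_of_ne h, Set.mem_singleton_iff] at hy
    exact hy ▸ .refl _

/-- The closed form contains nothing that is not derivable. -/
theorem Derives.of_mem_solveLetter {X : G.Var ⊕ α} {S : Set (ParWord (G.Var ⊕ α))}
    (hS : ∀ y ∈ S, G.Derives {X} y) {x : ParWord (G.Var ⊕ α)} (hx : x ∈ solveLetter X S) :
    G.Derives {X} x := by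
  obtain ⟨r, hr, c, hc, rfl⟩ := hx
  -- One `X` is kept and unfolded once per increment; only at the end is it replaced by the `X`-free
  -- word `r`.
  suffices h : G.Derives {X} ({X} + c) from h.trans ((hS r hr.1).add_right c)
  induction hc using AddSubmonoid.closure_induction_left with
  | zero => exact .refl _
  | add_left g hg c _ ih =>
    obtain ⟨d, hd, hg⟩ := mem_substLang.1 hg
    refine ih.trans ?_
    rw [← add_assoc]
    refine Derives.add_right ((hS _ hd).trans ?_) c
    rw [← Multiset.singleton_add]
    exact (Derives.refl _).add (.of_mem_substWord_replaceLetter (fun y hy => hS y hy.1) hg)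

theorem Derives.of_mem_eliminate {P : G.Var ⊕ α → Set (ParWord (G.Var ⊕ α))}
    (hP : ∀ c, ∀ y ∈ P c, G.Derives {c} y) (l : List (G.Var ⊕ α)) {c : G.Var ⊕ α}
    {x : ParWord (G.Var ⊕ α)} (hx : x ∈ eliminate P l c) : G.Derives {c} x := by
  induction l generalizing c x with
  | nil => exact hP c x hx
  | cons X l ih =>
    obtain ⟨m, hm, hx⟩ := mem_substLang.1 hx
    exact (ih hm).trans
      (.of_mem_substWord_replaceLetter (fun y hy => .of_mem_solveLetter (fun _ => ih) hy) hx)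

end Elimination

/-- A family of languages that is closed under the productions contains all derivable words. -/
theorem Derives.mem_substWord {N : G.Var → Set (ParWord α)}
    (hN : ∀ A β, (A, β) ∈ G.prods → substWord (Sum.elim N fun a => {{a}}) β ⊆ N A)
    {m : ParWord (G.Var ⊕ α)} {w : ParWord α} (h : G.Derives m (w.map Sum.inr)) :
    w ∈ substWord (Sum.elim N fun a => {{a}}) m := by
  induction h using Relation.ReflTransGen.head_induction_on with
  | refl =>
    rw [substWord_map_inr]; rfl
  | head h _ ih =>
    obtain ⟨A, β, δ, hA, rfl, rfl⟩ := h
    rw [substWord_add] at ih ⊢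
    rw [substWord_singleton]
    exact Set.add_subset_add (hN A β hA) subset_rfl ih

/-- The derived languages form the least family closed under the productions; every upper bound on a
grammar below comes from a suitable `N`. -/
theorem languageFrom_subset {N : G.Var → Set (ParWord α)}
    (hN : ∀ A β, (A, β) ∈ G.prods → substWord (Sum.elim N fun a => {{a}}) β ⊆ N A) (A : G.Var) :
    G.languageFrom A ⊆ N A := fun w hw => by
  simpa using Derives.mem_substWord hN hw

/-- **Parikh's theorem**: the words derivable in a context free parallel grammar form a semilinear
set. -/
theorem isSemilinearSet_languageFrom (G : ParallelGrammar α) (A : G.Var) :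
    IsSemilinearSet (G.languageFrom A) := by
  classical
  have := G.finite_var
  have := Fintype.ofFinite G.Var
  -- The grammar as a system of equations; terminals stand for themselves and are not eliminated.
  let P : G.Var ⊕ α → Set (ParWord (G.Var ⊕ α)) :=
    Sum.elim (fun B => {β | (B, β) ∈ G.prods}) fun a => {{Sum.inr a}}
  let l : List (G.Var ⊕ α) := (Finset.univ : Finset G.Var).toList.map Sum.inl
  have hPl : ∀ c ∉ l, P c = {{c}} := by
    rintro (B | a) h
    · simp [l] at h
    · rfl
  have hPlin : ∀ c, IsSemilinearSet (P c) := by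
    rintro (B | a)
    · refine .of_finite (Set.Finite.subset (G.finite_prods.image Prod.snd) ?_)
      exact fun β hβ => ⟨_, hβ, rfl⟩
    · exact .singleton _
  have hPder : ∀ c, ∀ y ∈ P c, G.Derives {c} y := by
    rintro (B | a) y hy
    · exact .of_mem_prods hy
    · exact (Set.mem_singleton_iff.1 hy) ▸ .refl _
  -- The eliminated system is closed under the productions, which gives `⊆`, and all its words are
  -- derivable, which gives `⊇`. The outer substitution only strips `Sum.inr`.
  have hlang : G.languageFrom A =
      substLang (Sum.elim (fun _ => ∅) fun a => {{a}}) (eliminate P l (Sum.inl A)) := by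
    ext w
    constructor
    · intro hw
      have hw' : w.map Sum.inr ∈ eliminate P l (Sum.inl A) := by
        refine languageFrom_subset
          (N := fun B => {w | w.map Sum.inr ∈ eliminate P l (Sum.inl B)}) ?_ A hw
        intro B β hβ x hx
        change x.map Sum.inr ∈ eliminate P l (Sum.inl B)
        rw [← substLang_eliminate hPl]
        refine mem_substLang.2 ⟨β, hβ, ?_⟩
        refine map_inr_mem_substWord (fun _ _ hy => hy) (fun a => ?_) hx
        exact eliminate_of_notMem (by simp [l]) rfl
      exact mem_substLang.2 ⟨_, hw', by rw [substWord_map_inr]; rfl⟩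
    · intro hw
      obtain ⟨m, hm, hw⟩ := mem_substLang.1 hw
      rw [eq_map_inr_of_mem_substWord hw] at hm
      exact Derives.of_mem_eliminate hPder l hm
  rw [hlang]
  refine .substLang ?_ (.eliminate hPlin l _)
  rintro (B | a)
  · exact .empty
  · exact .singleton _

end ParallelGrammar

/-! ### Recognizing parallel words among series-parallel words. -/

namespace SPTerm

variable {α : Type*}

/-- The multiset of letters of a term. -/
def letters : SPTerm α → Multiset α
  | empty => 0
  | letter a => {a}
  | seq x y => x.letters + y.letters
  | par x y => x.letters + y.letters

/-- A term without a sequential composition of two nonempty words. -/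
def IsPar : SPTerm α → Prop
  | empty => True
  | letter _ => True
  | seq x y => (x.letters = 0 ∨ y.letters = 0) ∧ x.IsPar ∧ y.IsPar
  | par x y => x.IsPar ∧ y.IsPar

theorem Equiv.letters_eq {x y : SPTerm α} (h : Equiv x y) : x.letters = y.letters := by
  induction h with
  | refl => rfl
  | symm _ ih => exact ih.symm
  | trans _ _ ih ih' => exact ih.trans ih'
  | seq_congr _ _ ih ih' => simp [letters, ih, ih']
  | par_congr _ _ ih ih' => simp [letters, ih, ih']
  | seq_assoc => simp [letters, add_assoc]
  | empty_seq => simp [letters]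
  | seq_empty => simp [letters]
  | par_assoc => simp [letters, add_assoc]
  | par_comm => simp [letters, add_comm]
  | empty_par => simp [letters]

/-- In `IsPar` emptiness of a factor is expressed by `letters`, which is already known to be
invariant; this handles the congruence and unit laws of `seq`. -/
theorem Equiv.isPar_iff {x y : SPTerm α} (h : Equiv x y) : x.IsPar ↔ y.IsPar := by
  induction h with
  | refl => rfl
  | symm _ ih => exact ih.symm
  | trans _ _ ih ih' => exact ih.trans ih'
  | seq_congr h h' ih ih' => simp [IsPar, ih, ih', h.letters_eq, h'.letters_eq]
  | par_congr _ _ ih ih' => simp [IsPar, ih, ih']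
  | seq_assoc => simp only [IsPar, letters, add_eq_zero]; tauto
  | empty_seq => simp [IsPar, letters]
  | seq_empty => simp [IsPar, letters]
  | par_assoc => simp only [IsPar]; tauto
  | par_comm => simp only [IsPar]; tauto
  | empty_par => simp [IsPar]

end SPTerm

namespace SPWord

variable {α : Type*}

/-- The multiset of letters of a series-parallel word. -/
def letters (x : SPWord α) : Multiset α :=
  Quotient.lift SPTerm.letters (fun _ _ => SPTerm.Equiv.letters_eq) x

/-- A word that is not a sequential composition of nonempty words, and whose parallel components
are not either. -/
def IsPar (x : SPWord α) : Prop :=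
  Quotient.lift SPTerm.IsPar (fun _ _ h => propext (SPTerm.Equiv.isPar_iff h)) x

@[simp] theorem letters_letter (a : α) : (letter a).letters = {a} := rfl

@[simp] theorem letters_seq (x y : SPWord α) : (seq x y).letters = x.letters + y.letters := by
  induction x using Quotient.inductionOn
  induction y using Quotient.inductionOn
  rfl

@[simp] theorem letters_par (x y : SPWord α) : (par x y).letters = x.letters + y.letters := by
  induction x using Quotient.inductionOn
  induction y using Quotient.inductionOn
  rfl

theorem isPar_empty : (empty : SPWord α).IsPar := trivial

theorem isPar_letter (a : α) : (letter a).IsPar := trivial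

theorem isPar_seq {x y : SPWord α} :
    (seq x y).IsPar ↔ (x.letters = 0 ∨ y.letters = 0) ∧ x.IsPar ∧ y.IsPar := by
  induction x using Quotient.inductionOn
  induction y using Quotient.inductionOn
  rfl

theorem isPar_par {x y : SPWord α} : (par x y).IsPar ↔ x.IsPar ∧ y.IsPar := by
  induction x using Quotient.inductionOn
  induction y using Quotient.inductionOn
  rfl

@[simp] theorem empty_seq (x : SPWord α) : seq empty x = x := by
  induction x using Quotient.inductionOn
  exact Quotient.sound (.empty_seq _)

@[simp] theorem seq_empty (x : SPWord α) : seq x empty = x := by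
  induction x using Quotient.inductionOn
  exact Quotient.sound (.seq_empty _)

@[simp] theorem empty_par (x : SPWord α) : par empty x = x := by
  induction x using Quotient.inductionOn
  exact Quotient.sound (.empty_par _)

@[simp] theorem par_empty (x : SPWord α) : par x empty = x := by
  rw [par_comm, empty_par]

theorem induction {p : SPWord α → Prop} (empty : p empty) (letter : ∀ a, p (letter a))
    (seq : ∀ x y, p x → p y → p (seq x y)) (par : ∀ x y, p x → p y → p (par x y))
    (x : SPWord α) : p x := by
  induction x using Quotient.inductionOn with
  | h t =>
    induction t with
    | empty => exact empty
    | letter a => exact letter a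
    | seq x y ihx ihy => exact seq _ _ ihx ihy
    | par x y ihx ihy => exact par _ _ ihx ihy

theorem eq_empty_of_letters_eq_zero {x : SPWord α} (h : x.letters = 0) : x = empty := by
  induction x using SPWord.induction with
  | empty => rfl
  | letter a => simp at h
  | seq x y ihx ihy =>
    rw [letters_seq, add_eq_zero] at h
    rw [ihx h.1, ihy h.2, empty_seq]
  | par x y ihx ihy =>
    rw [letters_par, add_eq_zero] at h
    rw [ihx h.1, ihy h.2, empty_par]

end SPWord

namespace ParWord

open SPWord

variable {α : Type*}

@[simp] theorem toSP_zero : (0 : ParWord α).toSP = empty := rfl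

@[simp] theorem toSP_cons (a : α) (w : ParWord α) : toSP (a ::ₘ w) = par (letter a) w.toSP :=
  Multiset.foldr_cons _ _ _ _

@[simp] theorem toSP_singleton (a : α) : toSP {a} = letter a := by
  rw [← Multiset.cons_zero, toSP_cons, toSP_zero, par_empty]

theorem toSP_add (v w : ParWord α) : toSP (v + w) = par v.toSP w.toSP := by
  induction v using Multiset.induction_on with
  | empty => simp
  | cons a v ih => rw [Multiset.cons_add, toSP_cons, ih, toSP_cons, par_assoc]

@[simp] theorem letters_toSP (w : ParWord α) : w.toSP.letters = w := by
  induction w using Multiset.induction_on with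
  | empty => rfl
  | cons a w ih => rw [toSP_cons, letters_par, ih, letters_letter, Multiset.singleton_add]

theorem toSP_injective : Function.Injective (toSP : ParWord α → SPWord α) :=
  Function.LeftInverse.injective letters_toSP

theorem isPar_toSP (w : ParWord α) : w.toSP.IsPar := by
  induction w using Multiset.induction_on with
  | empty => exact isPar_empty
  | cons a w ih => rw [toSP_cons]; exact isPar_par.2 ⟨isPar_letter a, ih⟩

/-- With `isPar_toSP` this identifies the range of `toSP` with the words satisfying `IsPar`, so
factors of parallel words are parallel. -/
theorem toSP_letters {x : SPWord α} (h : x.IsPar) : toSP x.letters = x := by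
  induction x using SPWord.induction with
  | empty => rfl
  | letter a => simp
  | seq x y ihx ihy =>
    obtain ⟨h | h, hx, hy⟩ := isPar_seq.1 h
    · rw [letters_seq, h, zero_add, ihy hy, eq_empty_of_letters_eq_zero h, empty_seq]
    · rw [letters_seq, h, add_zero, ihx hx, eq_empty_of_letters_eq_zero h, seq_empty]
  | par x y ihx ihy =>
    obtain ⟨hx, hy⟩ := isPar_par.1 h
    rw [letters_par, toSP_add, ihx hx, ihy hy]

theorem seq_eq_toSP {x y : SPWord α} {w : ParWord α} (h : seq x y = w.toSP) :
    (x = empty ∧ y = w.toSP) ∨ (x = w.toSP ∧ y = empty) := by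
  have hp : (seq x y).IsPar := h ▸ isPar_toSP w
  rcases (isPar_seq.1 hp).1 with hx | hy
  · rw [eq_empty_of_letters_eq_zero hx, empty_seq] at h
    exact .inl ⟨eq_empty_of_letters_eq_zero hx, h⟩
  · rw [eq_empty_of_letters_eq_zero hy, seq_empty] at h
    exact .inr ⟨h, eq_empty_of_letters_eq_zero hy⟩

theorem par_eq_toSP {x y : SPWord α} {w : ParWord α} (h : par x y = w.toSP) :
    ∃ u v : ParWord α, x = u.toSP ∧ y = v.toSP ∧ w = u + v := by
  have hp : (par x y).IsPar := h ▸ isPar_toSP w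
  obtain ⟨hx, hy⟩ := isPar_par.1 hp
  refine ⟨x.letters, y.letters, (toSP_letters hx).symm, (toSP_letters hy).symm, ?_⟩
  rw [← letters_par, h, letters_toSP]

end ParWord

/-! ### Parallel regular languages are the semilinear sets. -/

section Rational

open ParWord

variable {α : Type*}

theorem image_toSP_add (L₁ L₂ : Set (ParWord α)) :
    toSP '' (L₁ + L₂) = parLang (toSP '' L₁) (toSP '' L₂) := by
  rw [← Set.image2_add, Set.image_image2, parLang, Set.image2_image_left, Set.image2_image_right]
  simp only [toSP_add]

theorem parStar_image_toSP (L : Set (ParWord α)) :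
    parStar (toSP '' L) = toSP '' (AddSubmonoid.closure L : Set (ParWord α)) := by
  ext x
  constructor
  · intro hx
    obtain ⟨n, hn⟩ := Set.mem_iUnion.1 hx
    clear hx
    induction n generalizing x with
    | zero => exact ⟨0, zero_mem _, hn.symm⟩
    | succ n ih =>
      obtain ⟨y, hy, _, ⟨v, hv, rfl⟩, rfl⟩ := hn
      obtain ⟨u, hu, rfl⟩ := ih y hy
      exact ⟨u + v, add_mem hu (AddSubmonoid.subset_closure hv), toSP_add u v⟩
  · rintro ⟨w, hw, rfl⟩
    induction hw using AddSubmonoid.closure_induction_right with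
    | zero => exact Set.mem_iUnion.2 ⟨0, rfl⟩
    | add_right u _ v hv ih =>
      obtain ⟨n, hn⟩ := Set.mem_iUnion.1 ih
      refine Set.mem_iUnion.2 ⟨n + 1, ?_⟩
      rw [toSP_add]
      exact ⟨_, hn, _, ⟨v, hv, rfl⟩, rfl⟩

theorem isParallelRational_singleton_toSP (w : ParWord α) :
    IsParallelRational ({w.toSP} : Set (SPWord α)) := by
  induction w using Multiset.induction_on with
  | empty =>
    -- The language `{ε}` is not a base case; it arises as `∅^⊕`.
    have h : IsParallelRational (parStar (toSP '' (∅ : Set (ParWord α)))) := by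
      rw [Set.image_empty]
      exact .parStar .empty
    rw [parStar_image_toSP] at h
    simpa using h
  | cons a w ih =>
    have h := IsParallelRational.par (.letter a) ih
    rwa [parLang, Set.image2_singleton, ← toSP_cons] at h

theorem IsSemilinearSet.isParallelRegular {L : Set (ParWord α)} (hL : IsSemilinearSet L) :
    IsParallelRegular L := by
  refine hL.induction (p := IsParallelRegular) ?_ (fun w => ?_) (fun s t hs ht => ?_)
    (fun s t hs ht => ?_) (fun s hs => ?_)
  · rw [IsParallelRegular, Set.image_empty]; exact .empty
  · rw [IsParallelRegular, Set.image_singleton]; exact isParallelRational_singleton_toSP w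
  · rw [IsParallelRegular, Set.image_union]; exact .union hs ht
  · rw [IsParallelRegular, image_toSP_add]; exact .par hs ht
  · rw [IsParallelRegular, ← parStar_image_toSP]; exact .parStar hs

theorem preimage_toSP_parLang (K₁ K₂ : Set (SPWord α)) :
    toSP ⁻¹' parLang K₁ K₂ = toSP ⁻¹' K₁ + toSP ⁻¹' K₂ := by
  ext w
  constructor
  · rintro ⟨x, hx, y, hy, h⟩
    obtain ⟨u, v, rfl, rfl, rfl⟩ := par_eq_toSP h
    exact ⟨u, hx, v, hy, rfl⟩
  · rintro ⟨u, hu, v, hv, rfl⟩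
    exact ⟨_, hu, _, hv, (toSP_add u v).symm⟩

theorem preimage_toSP_parStar (K : Set (SPWord α)) :
    toSP ⁻¹' parStar K = (AddSubmonoid.closure (toSP ⁻¹' K) : Set (ParWord α)) := by
  -- Parallel factors of a parallel word are parallel, so only the parallel words of `K` matter.
  have hpow : ∀ n, toSP ⁻¹' parPow K n = toSP ⁻¹' parPow (toSP '' (toSP ⁻¹' K)) n := by
    intro n
    induction n with
    | zero => rfl
    | succ n ih =>
      rw [parPow, parPow, preimage_toSP_parLang, preimage_toSP_parLang, ih,
        Set.preimage_image_eq _ toSP_injective]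
  rw [← Set.preimage_image_eq (AddSubmonoid.closure (toSP ⁻¹' K) : Set (ParWord α)) toSP_injective,
    ← parStar_image_toSP, parStar, parStar, Set.preimage_iUnion, Set.preimage_iUnion]
  exact Set.iUnion_congr hpow

/-- Preimages are used because the subexpressions of an expression for a parallel language may
denote words that are not parallel. -/
theorem IsParallelRational.isSemilinearSet_preimage {K : Set (SPWord α)}
    (hK : IsParallelRational K) : IsSemilinearSet (toSP ⁻¹' K) := by
  induction hK with
  | empty => exact .empty
  | letter a =>
    rw [← toSP_singleton, ← Set.image_singleton, Set.preimage_image_eq _ toSP_injective]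
    exact .singleton _
  | union _ _ ih ih' => exact ih.union ih'
  | par _ _ ih ih' => rw [preimage_toSP_parLang]; exact ih.add ih'
  | parStar _ ih => rw [preimage_toSP_parStar]; exact ih.closure
  | @seq K₁ K₂ _ _ ih ih' =>
    have h : toSP ⁻¹' seqLang K₁ K₂ =
        {w | SPWord.empty ∈ K₁ ∧ w.toSP ∈ K₂} ∪ {w | SPWord.empty ∈ K₂ ∧ w.toSP ∈ K₁} := by
      ext w
      constructor
      · rintro ⟨x, hx, y, hy, h⟩
        rcases seq_eq_toSP h with ⟨rfl, rfl⟩ | ⟨rfl, rfl⟩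
        · exact .inl ⟨hx, hy⟩
        · exact .inr ⟨hy, hx⟩
      · rintro (⟨h, hw⟩ | ⟨h, hw⟩)
        · exact ⟨_, h, _, hw, SPWord.empty_seq _⟩
        · exact ⟨_, hw, _, h, SPWord.seq_empty _⟩
    rw [h]
    refine .union ?_ ?_
    · by_cases h : SPWord.empty ∈ K₁
      · simp only [h, true_and]; exact ih'
      · simp [h]
    · by_cases h : SPWord.empty ∈ K₂
      · simp only [h, true_and]; exact ih
      · simp [h]

theorem IsParallelRegular.isSemilinearSet {L : Set (ParWord α)} (hL : IsParallelRegular L) :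
    IsSemilinearSet L := by
  have h := IsParallelRational.isSemilinearSet_preimage hL
  rwa [Set.preimage_image_eq _ toSP_injective] at h

end Rational

/-! ### From semilinear sets to linear grammars. -/

namespace IsSemilinearSet

variable {α : Type*}

/-- The linear grammar of the union of the linear sets `v i + closure (F i)`. -/
abbrev grammar {n : ℕ} (v : Fin n → ParWord α) (F : Fin n → Set (ParWord α))
    (hF : ∀ i, (F i).Finite) : ParallelGrammar α where
  Var := Option (Fin n)
  finite_var := inferInstance
  prods := (Set.range fun i => (none, (v i).map Sum.inr + {Sum.inl (some i)})) ∪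
    (⋃ i, (fun f : ParWord α => (some i, f.map Sum.inr + {Sum.inl (some i)})) '' F i) ∪
    Set.range fun i => (some i, 0)
  finite_prods := ((Set.finite_range _).union
    (Set.finite_iUnion fun i => (hF i).image _)).union (Set.finite_range _)
  start := none

theorem exists_linear_grammar {L : Set (ParWord α)} (hL : IsSemilinearSet L) :
    ∃ G : ParallelGrammar α, G.IsLinear ∧ G.language = L := by
  obtain ⟨S, hS, hlin, rfl⟩ := hL
  have := hS.to_subtype
  -- Variables must live in `Type`, whatever the universe of `α`, so the components are indexed by
  -- `Fin n`.
  obtain ⟨n, ⟨e⟩⟩ := Finite.exists_equiv_fin S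
  choose v F hF hvF using fun i => hlin _ (e.symm i).2
  have hmem : ∀ w, w ∈ ⋃₀ S ↔ ∃ i, ∃ c ∈ AddSubmonoid.closure (F i), v i + c = w := by
    intro w
    constructor
    · rintro ⟨s, hs, hw⟩
      have h := hvF (e ⟨s, hs⟩)
      rw [Equiv.symm_apply_apply] at h
      change s = _ at h
      rw [h] at hw
      exact ⟨_, hw⟩
    · rintro ⟨i, c, hc, rfl⟩
      refine ⟨_, (e.symm i).2, ?_⟩
      rw [hvF i]
      exact ⟨c, hc, rfl⟩
  refine ⟨grammar v F hF, ?_, ?_⟩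
  · rintro A β ((⟨i, h⟩ | h) | ⟨i, h⟩)
    · cases h
      exact .inl ⟨_, _, rfl⟩
    · obtain ⟨i, f, -, h⟩ := Set.mem_iUnion.1 h
      cases h
      exact .inl ⟨_, _, rfl⟩
    · cases h
      exact .inr ⟨0, rfl⟩
  · apply Set.Subset.antisymm
    · refine ParallelGrammar.languageFrom_subset (G := grammar v F hF)
        (N := fun A => A.elim (⋃₀ S) fun i => AddSubmonoid.closure (F i)) ?_ none
      rintro A β ((⟨i, h⟩ | h) | ⟨i, h⟩) w hw
      · cases h
        rw [substWord_add, substWord_map_inr, substWord_singleton] at hw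
        obtain ⟨_, rfl, c, hc, rfl⟩ := hw
        exact (hmem _).2 ⟨i, c, hc, rfl⟩
      · obtain ⟨i, f, hf, h⟩ := Set.mem_iUnion.1 h
        cases h
        rw [substWord_add, substWord_map_inr, substWord_singleton] at hw
        obtain ⟨_, rfl, c, hc, rfl⟩ := hw
        exact add_mem (AddSubmonoid.subset_closure hf) hc
      · cases h
        rw [substWord_zero, Set.mem_singleton_iff] at hw
        exact hw ▸ zero_mem _
    · intro w hw
      obtain ⟨i, c, hc, rfl⟩ := (hmem w).1 hw
      clear hw
      have hc' : (grammar v F hF).Derives {Sum.inl (some i)} (c.map Sum.inr) := by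
        induction hc using AddSubmonoid.closure_induction_left with
        | zero => exact .of_mem_prods (.inr ⟨i, rfl⟩)
        | add_left f hf c _ ih =>
          rw [Multiset.map_add]
          refine .trans (.of_mem_prods (.inl (.inr (Set.mem_iUnion.2 ⟨i, f, hf, rfl⟩)))) ?_
          exact .add (.refl _) ih
      refine ParallelGrammar.Derives.trans (.of_mem_prods (.inl (.inl ⟨i, rfl⟩))) ?_
      rw [Multiset.map_add]
      exact .add (.refl _) hc'

end IsSemilinearSet

/-! ### From linear grammars to branching automata. -/

namespace ParallelGrammar

variable {α : Type*}

/-- States of the automaton of a linear grammar with variables `V`: from `var A` to `sink` it reads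
the words derivable from `A`, from `side A B` to `sideSink` the words `x` of productions
`A → x ‖ B`. The states `deadSource` and `deadSink` only serve to build forks and joins that are
used in parallel transitions. -/
inductive LinearState (V : Type) : Type
  | var (A : V)
  | side (A B : V)
  | sink
  | sideSink
  | deadSource
  | deadSink

instance (V : Type) [Finite V] : Finite (LinearState V) := by
  refine Finite.of_surjective (α := (V ⊕ V × V) ⊕ (Bool × Bool)) (Sum.elim
    (Sum.elim LinearState.var fun p => LinearState.side p.1 p.2) fun b =>
      bif b.1 then (bif b.2 then .sink else .sideSink)
      else (bif b.2 then .deadSource else .deadSink)) ?_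
  rintro (A | ⟨A, B⟩ | _ | _ | _ | _)
  · exact ⟨.inl (.inl A), rfl⟩
  · exact ⟨.inl (.inr (A, B)), rfl⟩
  · exact ⟨.inr (true, true), rfl⟩
  · exact ⟨.inr (true, false), rfl⟩
  · exact ⟨.inr (false, true), rfl⟩
  · exact ⟨.inr (false, false), rfl⟩

open LinearState

/-- A parallel transition through a fork and a join that cannot be used otherwise. -/
def parThrough {V : Type} (p : LinearState V) (w : ParWord α) (q : LinearState V) :
    (LinearState V × Multiset (LinearState V)) × ParWord α ×
      (Multiset (LinearState V) × LinearState V) :=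
  ((p, {deadSource, deadSource}), w, ({deadSink, deadSink}, q))

/-- The parallel transitions of the automaton of a linear grammar. -/
def linearParTrans (G : ParallelGrammar α) :
    Set ((LinearState G.Var × Multiset (LinearState G.Var)) × ParWord α ×
      (Multiset (LinearState G.Var) × LinearState G.Var)) :=
  {t | ∃ A w, (A, w.map Sum.inr) ∈ G.prods ∧ t = parThrough (var A) w sink} ∪
    {t | ∃ A B w, (A, w.map Sum.inr + {Sum.inl B}) ∈ G.prods ∧
      t = parThrough (side A B) w sideSink}

theorem finite_linearParTrans (G : ParallelGrammar α) : G.linearParTrans.Finite := by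
  have := G.finite_var
  have hinj : Function.Injective (Multiset.map (Sum.inr : α → G.Var ⊕ α)) :=
    Multiset.map_injective Sum.inr_injective
  refine .union ?_ ?_
  · refine ((G.finite_prods.preimage (f := fun t : G.Var × ParWord α => (t.1, t.2.map Sum.inr))
      ?_).image fun t => parThrough (var t.1) t.2 sink).subset ?_
    · rintro ⟨A, w⟩ - ⟨A', w'⟩ - h
      simpa [hinj.eq_iff] using h
    · rintro _ ⟨A, w, h, rfl⟩
      exact ⟨(A, w), h, rfl⟩
  · refine (Set.finite_iUnion fun B => (G.finite_prods.preimage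
      (f := fun t : G.Var × ParWord α => (t.1, t.2.map Sum.inr + {Sum.inl B})) ?_).image
        fun t => parThrough (side t.1 B) t.2 sideSink).subset ?_
    · rintro ⟨A, w⟩ - ⟨A', w'⟩ - h
      simpa [hinj.eq_iff] using h
    · rintro _ ⟨A, B, w, h, rfl⟩
      exact Set.mem_iUnion.2 ⟨B, (A, w), h, rfl⟩

/-- The branching automaton of a linear grammar. -/
abbrev toAutomaton (G : ParallelGrammar α) : BranchingAutomaton α where
  State := LinearState G.Var
  finite_state := have := G.finite_var; inferInstance
  seqTrans := ∅
  forkTrans := (Set.range fun p : G.Var × G.Var => (var p.1, {var p.2, side p.1 p.2})) ∪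
    Set.range fun p => (p, {deadSource, deadSource})
  joinTrans := {({sink, sideSink}, sink)} ∪ Set.range fun q => ({deadSink, deadSink}, q)
  parTrans := G.linearParTrans
  finite_seq := Set.finite_empty
  finite_fork := have := G.finite_var; (Set.finite_range _).union (Set.finite_range _)
  finite_join := have := G.finite_var; (Set.finite_singleton _).union (Set.finite_range _)
  finite_par := G.finite_linearParTrans
  two_le_card_fork := by
    rintro _ (⟨p, rfl⟩ | ⟨p, rfl⟩) <;> simp
  two_le_card_join := by
    rintro _ (rfl | ⟨p, rfl⟩) <;> simp
  par_subset := by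
    rintro _ (⟨A, w, -, rfl⟩ | ⟨A, B, w, -, rfl⟩) <;> exact ⟨.inr ⟨_, rfl⟩, .inr ⟨_, rfl⟩⟩
  start := {var G.start}
  final := {sink}

/-- The possible runs of the automaton of a linear grammar. -/
def LinearRun (G : ParallelGrammar α) (p : LinearState G.Var) (x : SPWord α)
    (q : LinearState G.Var) : Prop :=
  (p = q ∧ x = SPWord.empty) ∨
  (∃ A, ∃ w ∈ G.languageFrom A, p = var A ∧ q = sink ∧ x = w.toSP) ∨
  ∃ A B, ∃ w : ParWord α, (A, w.map Sum.inr + {Sum.inl B}) ∈ G.prods ∧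
    p = side A B ∧ q = sideSink ∧ x = w.toSP

theorem LinearRun.exists_of_var {G : ParallelGrammar α} {p q : LinearState G.Var} {x : SPWord α}
    (h : G.LinearRun p x q) {A : G.Var} (hp : p = var A) (hq : q = sink ∨ q = sideSink) :
    ∃ w ∈ G.languageFrom A, x = w.toSP := by
  subst hp
  rcases h with ⟨rfl, -⟩ | ⟨_, w, hw, h, -, hx⟩ | ⟨_, _, _, _, h, _⟩
  · rcases hq with h | h <;> cases h
  · cases h
    exact ⟨w, hw, hx⟩
  · cases h

theorem LinearRun.exists_of_side {G : ParallelGrammar α} {p q : LinearState G.Var} {x : SPWord α}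
    (h : G.LinearRun p x q) {A B : G.Var} (hp : p = side A B) (hq : q = sink ∨ q = sideSink) :
    ∃ w : ParWord α, (A, w.map Sum.inr + {Sum.inl B}) ∈ G.prods ∧ x = w.toSP := by
  subst hp
  rcases h with ⟨rfl, -⟩ | ⟨_, _, _, h, _⟩ | ⟨_, _, w, hw, h, -, hx⟩
  · rcases hq with h | h <;> cases h
  · cases h
  · cases h
    exact ⟨w, hw, hx⟩

theorem pair_eq_pair {β : Type*} {a b c d : β} (h : ({a, b} : Multiset β) = {c, d}) :
    (a = c ∧ b = d) ∨ (a = d ∧ b = c) := by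
  simp only [Multiset.insert_eq_cons, Multiset.cons_eq_cons] at h
  rcases h with ⟨rfl, h⟩ | ⟨-, cs, h, h'⟩
  · exact .inl ⟨rfl, Multiset.singleton_inj.1 h⟩
  · have h1 := (Multiset.singleton_eq_cons_iff _).1 h
    have h2 := (Multiset.singleton_eq_cons_iff _).1 h'
    exact .inr ⟨h2.1.symm, h1.1⟩

/-- `LinearRun` is an invariant of runs. Sequential composition adds nothing, since by the invariant
only trivial runs leave `sink` or `sideSink`. -/
theorem linearRun_of_run {G : ParallelGrammar α} {p q : G.toAutomaton.State} {x : SPWord α}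
    (h : G.toAutomaton.Run p x q) : G.LinearRun p x q := by
  induction h with
  | empty p => exact Or.inl ⟨rfl, rfl⟩
  | letter h => exact h.elim
  | @seq p q r x y _ _ ih ih' =>
    rcases ih with ⟨rfl, rfl⟩ | ⟨A, w, hw, rfl, rfl, rfl⟩ | ⟨A, B, w, hw, rfl, rfl, rfl⟩
    · rwa [SPWord.empty_seq]
    · rcases ih' with ⟨rfl, rfl⟩ | ⟨_, _, _, h, _⟩ | ⟨_, _, _, _, h, _⟩
      · rw [SPWord.seq_empty]
        exact Or.inr (.inl ⟨A, w, hw, rfl, rfl, rfl⟩)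
      · cases h
      · cases h
    · rcases ih' with ⟨rfl, rfl⟩ | ⟨_, _, _, h, _⟩ | ⟨_, _, _, _, h, _⟩
      · rw [SPWord.seq_empty]
        exact Or.inr (.inr ⟨A, B, w, hw, rfl, rfl, rfl⟩)
      · cases h
      · cases h
  | @par p q M N w h =>
    rcases h with ⟨A, w, h, e⟩ | ⟨A, B, w, h, e⟩
    · cases e
      exact Or.inr (.inl ⟨A, w, .of_mem_prods h, rfl, rfl, rfl⟩)
    · cases e
      exact Or.inr (.inr ⟨A, B, w, h, rfl, rfl, rfl⟩)
  | @fork p q l hf hj _ ih =>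
    have hfst : ∀ {M : Multiset (LinearState G.Var)},
        M = (l.map fun t => t.1 : List (LinearState G.Var)) → ∀ t ∈ l, t.1 ∈ M := fun h t ht => by
      rw [h, Multiset.mem_coe]; exact List.mem_map_of_mem ht
    have hsnd : ∀ {s : LinearState G.Var} {N : Multiset (LinearState G.Var)},
        N = (l.map fun t => t.2.2 : List (LinearState G.Var)) → s ∈ N →
        ∃ t ∈ l, t.2.2 = s := fun h hs => by
      rw [h, Multiset.mem_coe] at hs; exact List.mem_map.1 hs
    rcases hf with ⟨⟨A, B⟩, hf⟩ | ⟨_, hf⟩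
    · obtain ⟨rfl, hfm⟩ := Prod.mk.inj hf
      rcases hj with hj | ⟨_, hj⟩
      · obtain ⟨hjm, rfl⟩ := Prod.mk.inj hj
        have hlen : l.length = 2 := by simpa using (congrArg Multiset.card hfm).symm
        obtain ⟨t, t', rfl⟩ := List.length_eq_two.1 hlen
        have hprod : ∀ {x y : SPWord α}, (∃ w ∈ G.languageFrom B, x = w.toSP) →
            (∃ w : ParWord α, (A, w.map Sum.inr + {Sum.inl B}) ∈ G.prods ∧ y = w.toSP) →
            G.LinearRun (var A) (SPWord.par x y) sink := by
          rintro _ _ ⟨u, hu, rfl⟩ ⟨v, hv, rfl⟩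
          refine Or.inr (.inl ⟨A, v + u, ?_, rfl, rfl, ?_⟩)
          · refine .trans (.of_mem_prods hv) ?_
            rw [Multiset.map_add]
            exact .add (.refl _) hu
          · rw [ParWord.toSP_add, SPWord.par_comm]
        have hmem : ∀ s ∈ [t, t'], s.2.2 = sink ∨ s.2.2 = sideSink := fun s hs => by
          have : s.2.2 ∈ ({sink, sideSink} : Multiset (LinearState G.Var)) := by
            rw [← hjm, Multiset.mem_coe]
            exact List.mem_map_of_mem (f := fun t => t.2.2) hs
          simpa using this
        have hvar : ∀ s ∈ [t, t'], s.1 = var B → ∃ w ∈ G.languageFrom B, s.2.1 = w.toSP :=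
          fun s hs h => (ih s hs).exists_of_var h (hmem s hs)
        have hside : ∀ s ∈ [t, t'], s.1 = side A B →
            ∃ w : ParWord α, (A, w.map Sum.inr + {Sum.inl B}) ∈ G.prods ∧ s.2.1 = w.toSP :=
          fun s hs h => (ih s hs).exists_of_side h (hmem s hs)
        simp only [List.map_cons, List.map_nil, List.foldr_cons, List.foldr_nil,
          SPWord.par_empty]
        rcases pair_eq_pair hfm with ⟨h, h'⟩ | ⟨h, h'⟩
        · exact hprod (hvar t (by simp) h.symm) (hside t' (by simp) h'.symm)
        · rw [SPWord.par_comm]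
          exact hprod (hvar t' (by simp) h.symm) (hside t (by simp) h'.symm)
      -- A branch ending in `deadSink` must be trivial, yet the fork has no branch starting there.
      · obtain ⟨hjm, rfl⟩ := Prod.mk.inj hj
        obtain ⟨t, ht, hts⟩ := hsnd (s := deadSink) hjm (by simp)
        have ht1 := hfst hfm t ht
        rcases ih t ht with ⟨h, -⟩ | ⟨_, _, _, _, h, _⟩ | ⟨_, _, _, _, _, h, _⟩
        · rw [h, hts] at ht1
          simp at ht1
        · cases hts.symm.trans h
        · cases hts.symm.trans h
    · obtain ⟨rfl, hfm⟩ := Prod.mk.inj hf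
      -- Only trivial runs leave `deadSource`, and no join accepts that state.
      have hdead : ∀ t ∈ l, t.2.2 = deadSource := fun t ht => by
        have ht1 : t.1 = deadSource := by simpa using hfst hfm t ht
        rcases ih t ht with ⟨h, -⟩ | ⟨_, _, _, h, _⟩ | ⟨_, _, _, _, h, _⟩
        · exact h ▸ ht1
        · cases ht1.symm.trans h
        · cases ht1.symm.trans h
      rcases hj with hj | ⟨_, hj⟩
      · obtain ⟨hjm, rfl⟩ := Prod.mk.inj hj
        obtain ⟨t, ht, hts⟩ := hsnd (s := sink) hjm.symm (by simp)
        cases hts.symm.trans (hdead t ht)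
      · obtain ⟨hjm, rfl⟩ := Prod.mk.inj hj
        obtain ⟨t, ht, hts⟩ := hsnd (s := deadSink) hjm (by simp)
        cases hts.symm.trans (hdead t ht)

theorem IsLinear.exists_automaton {G : ParallelGrammar α} (hG : G.IsLinear) :
    ∃ A : BranchingAutomaton α, A.language = ParWord.toSP '' G.language := by
  refine ⟨G.toAutomaton, ?_⟩
  ext x
  constructor
  · rintro ⟨_, rfl, _, rfl, h⟩
    rcases linearRun_of_run h with ⟨h, -⟩ | ⟨A, w, hw, hA, -, rfl⟩ | ⟨_, _, _, _, h, _⟩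
    · cases h
    · obtain rfl := LinearState.var.inj hA
      exact ⟨w, hw, rfl⟩
    · cases h
  · rintro ⟨w, hw, rfl⟩
    refine ⟨var G.start, rfl, sink, rfl, ?_⟩
    refine languageFrom_subset (N := fun A => {w | G.toAutomaton.Run (var A) w.toSP sink})
      ?_ G.start hw
    intro A β hβ w hw
    rcases hG A β hβ with ⟨u, B, rfl⟩ | ⟨u, rfl⟩
    · rw [substWord_add, substWord_map_inr, substWord_singleton] at hw
      obtain ⟨u, rfl, v, hv, rfl⟩ := hw
      have hu : G.toAutomaton.Run (side A B) (ParWord.toSP u) sideSink :=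
        .par (.inr ⟨A, B, u, hβ, rfl⟩)
      have hrun := BranchingAutomaton.Run.fork (A := G.toAutomaton) (p := var A) (q := sink)
        [(var B, ParWord.toSP v, sink), (side A B, ParWord.toSP u, sideSink)]
        (.inl ⟨(A, B), rfl⟩) (.inl rfl) (by
          simp only [List.mem_cons, List.not_mem_nil, or_false, forall_eq_or_imp, forall_eq]
          exact ⟨hv, hu⟩)
      simp only [List.map_cons, List.map_nil, List.foldr_cons, List.foldr_nil,
        SPWord.par_empty] at hrun
      change G.toAutomaton.Run (var A) (ParWord.toSP (u + v)) sink
      rwa [ParWord.toSP_add, SPWord.par_comm]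
    · rw [substWord_map_inr, Set.mem_singleton_iff] at hw
      subst hw
      exact .par (.inl ⟨A, w, hβ, rfl⟩)

end ParallelGrammar

/-! ### From branching automata to grammars, and semilinearity of the accepted parallel words. -/

namespace BranchingAutomaton

variable {α : Type*} (A : BranchingAutomaton α)

/-- The productions `(p, q) → β` of the grammar whose variable `(p, q)` derives the parallel words
that label a run from `p` to `q`. -/
inductive RunProd : A.State × A.State → ParWord ((A.State × A.State) ⊕ α) → Prop
  | empty {p q} : A.Run p SPWord.empty q → RunProd (p, q) 0
  | letter {p q a} : (p, a, q) ∈ A.seqTrans → RunProd (p, q) {Sum.inr a}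
  | unit {p p' q' q} : A.Run p SPWord.empty p' → A.Run q' SPWord.empty q →
      RunProd (p, q) {Sum.inl (p', q')}
  | fork {p q} (M : Multiset (A.State × A.State)) : (p, M.map Prod.fst) ∈ A.forkTrans →
      (M.map Prod.snd, q) ∈ A.joinTrans → RunProd (p, q) (M.map Sum.inl)
  | par {p q M N w} : ((p, M), w, (N, q)) ∈ A.parTrans → RunProd (p, q) (w.map Sum.inr)

theorem finite_runProd :
    {t : (A.State × A.State) × ParWord ((A.State × A.State) ⊕ α) | A.RunProd t.1 t.2}.Finite := by
  classical
  have := A.finite_state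
  have := Fintype.ofFinite A.State
  have hfork :
      {M : Multiset (A.State × A.State) | ∃ p, (p, M.map Prod.fst) ∈ A.forkTrans}.Finite := by
    -- Finitely many forks bound the size of `M`, and a finite state set has finitely many multisets
    -- of pairs of bounded size.
    obtain ⟨n, hn⟩ := (A.finite_fork.image fun t => Multiset.card t.2).bddAbove
    refine (Set.finite_iUnion fun k : Fin (n + 1) =>
      Set.finite_range fun s : Sym (A.State × A.State) k => (s : Multiset _)).subset ?_
    rintro M ⟨p, hM⟩
    have hcard : Multiset.card M ≤ n := by
      simpa using hn (Set.mem_image_of_mem (fun t => Multiset.card t.2) hM)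
    exact Set.mem_iUnion.2 ⟨⟨Multiset.card M, by omega⟩, ⟨M, rfl⟩, rfl⟩
  have hβ : (({0} ∪ (fun t : A.State × α × A.State => {Sum.inr t.2.1}) '' A.seqTrans ∪
      (Set.range fun t : A.State × A.State => {Sum.inl t}) ∪
      Multiset.map Sum.inl '' {M | ∃ p, (p, M.map Prod.fst) ∈ A.forkTrans} ∪
      (fun t => t.2.1.map Sum.inr) '' A.parTrans :
        Set (ParWord ((A.State × A.State) ⊕ α)))).Finite :=
    ((((Set.finite_singleton _).union (A.finite_seq.image _)).union (Set.finite_range _)).union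
      (hfork.image _)).union (A.finite_par.image _)
  refine ((Set.finite_univ (α := A.State × A.State)).prod hβ).subset ?_
  rintro ⟨_, _⟩ h
  refine ⟨trivial, ?_⟩
  rcases h with h | h | _ | ⟨M, hM, _⟩ | h
  · exact .inl (.inl (.inl (.inl rfl)))
  · exact .inl (.inl (.inl (.inr ⟨_, h, rfl⟩)))
  · exact .inl (.inl (.inr ⟨_, rfl⟩))
  · exact .inl (.inr ⟨M, ⟨_, hM⟩, rfl⟩)
  · exact .inr ⟨_, h, rfl⟩

/-- The grammar of the parallel words that label a run from `p` to `q`. -/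
abbrev runGrammar (p q : A.State) : ParallelGrammar α where
  Var := A.State × A.State
  finite_var := have := A.finite_state; inferInstance
  prods := {t | A.RunProd t.1 t.2}
  finite_prods := A.finite_runProd
  start := (p, q)

variable {A}

theorem exists_branches {M : Multiset (A.State × A.State)} {w : ParWord α}
    (hw : w ∈ substWord (Sum.elim (fun s : A.State × A.State =>
      {w | A.Run s.1 (ParWord.toSP w) s.2}) fun a => {{a}}) (M.map Sum.inl)) :
    ∃ l : List (A.State × SPWord α × A.State),
      (↑(l.map fun t => t.1) : Multiset A.State) = M.map Prod.fst ∧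
      (↑(l.map fun t => t.2.2) : Multiset A.State) = M.map Prod.snd ∧
      (∀ t ∈ l, A.Run t.1 t.2.1 t.2.2) ∧
      (l.map fun t => t.2.1).foldr SPWord.par SPWord.empty = w.toSP := by
  induction M using Multiset.induction_on generalizing w with
  | empty =>
    rw [Multiset.map_zero, substWord_zero, Set.mem_singleton_iff] at hw
    subst hw
    exact ⟨[], rfl, rfl, by simp, rfl⟩
  | cons s M ih =>
    rw [Multiset.map_cons, substWord_cons] at hw
    obtain ⟨u, hu, v, hv, rfl⟩ := hw
    obtain ⟨l, h₁, h₂, h₃, h₄⟩ := ih hv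
    refine ⟨(s.1, ParWord.toSP u, s.2) :: l, ?_, ?_, ?_, ?_⟩
    · simp [← h₁]
    · simp [← h₂]
    · rintro t (_ | ⟨_, ht⟩)
      · exact hu
      · exact h₃ t ht
    · rw [List.map_cons, List.foldr_cons, h₄]
      exact (ParWord.toSP_add u v).symm

theorem RunProd.run {t : A.State × A.State} {β : ParWord ((A.State × A.State) ⊕ α)}
    (h : A.RunProd t β) {w : ParWord α}
    (hw : w ∈ substWord (Sum.elim (fun s : A.State × A.State =>
      {w | A.Run s.1 (ParWord.toSP w) s.2}) fun a => {{a}}) β) : A.Run t.1 w.toSP t.2 := by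
  cases h with
  | empty h =>
    rw [substWord_zero, Set.mem_singleton_iff] at hw
    exact hw ▸ h
  | letter h =>
    rw [substWord_singleton, Sum.elim_inr, Set.mem_singleton_iff] at hw
    rw [hw, ParWord.toSP_singleton]
    exact .letter h
  | unit h h' =>
    rw [substWord_singleton] at hw
    have := Run.seq (Run.seq h hw) h'
    rwa [SPWord.empty_seq, SPWord.seq_empty] at this
  | fork M hf hj =>
    obtain ⟨l, h₁, h₂, h₃, h₄⟩ := exists_branches hw
    rw [← h₄]
    exact .fork l (h₁ ▸ hf) (h₂ ▸ hj) h₃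
  | par h =>
    rw [substWord_map_inr, Set.mem_singleton_iff] at hw
    exact hw ▸ .par h

theorem run_of_mem_languageFrom {p q p' q' : A.State} {w : ParWord α}
    (hw : w ∈ (A.runGrammar p q).languageFrom (p', q')) : A.Run p' w.toSP q' :=
  ParallelGrammar.languageFrom_subset (G := A.runGrammar p q)
    (N := fun s => {w | A.Run s.1 (ParWord.toSP w) s.2}) (fun _ _ h _ hw => h.run hw) (p', q') hw

theorem derives_branches {G : ParallelGrammar α} (f : A.State × A.State → G.Var)
    (l : List (A.State × SPWord α × A.State))
    (hl : ∀ t ∈ l, ∀ w : ParWord α, t.2.1 = w.toSP → w ∈ G.languageFrom (f (t.1, t.2.2)))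
    {w : ParWord α} (hw : (l.map fun t => t.2.1).foldr SPWord.par SPWord.empty = w.toSP) :
    G.Derives (l.map fun t => Sum.inl (f (t.1, t.2.2)) : List (G.Var ⊕ α))
      (w.map Sum.inr) := by
  induction l generalizing w with
  | nil =>
    obtain rfl : 0 = w := ParWord.toSP_injective hw
    exact .refl _
  | cons t l ih =>
    obtain ⟨u, v, hu, hv, rfl⟩ := ParWord.par_eq_toSP hw
    rw [Multiset.map_add, List.map_cons, ← Multiset.cons_coe, ← Multiset.singleton_add]
    exact .add (hl t List.mem_cons_self u hu)
      (ih (fun s hs => hl s (List.mem_cons_of_mem t hs)) hv)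

/-- In a sequential step labelled by a parallel word one half runs on `ε`; a `unit` production
absorbs that half. Thus no production has to express sequential composition. -/
theorem Run.mem_languageFrom {p q p' q' : A.State} {x : SPWord α} (h : A.Run p' x q')
    {w : ParWord α} (hw : x = w.toSP) : w ∈ (A.runGrammar p q).languageFrom (p', q') := by
  induction h generalizing w with
  | empty p' =>
    obtain rfl : 0 = w := ParWord.toSP_injective hw
    exact .of_mem_prods (RunProd.empty (.empty p'))
  | @letter _ _ a h =>
    obtain rfl : {a} = w := ParWord.toSP_injective ((ParWord.toSP_singleton a).trans hw)
    exact .of_mem_prods (RunProd.letter h)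
  | @seq p₁ p₂ p₃ x y h h' ih ih' =>
    rcases ParWord.seq_eq_toSP hw with ⟨rfl, hy⟩ | ⟨hx, rfl⟩
    · exact .trans (.of_mem_prods (RunProd.unit h (.empty p₃))) (ih' hy)
    · exact .trans (.of_mem_prods (RunProd.unit (.empty p₁) h')) (ih hx)
  | @fork p₁ p₂ l hf hj _ ih =>
    have hprod : A.RunProd (p₁, p₂) (Multiset.map Sum.inl ↑(l.map fun t => (t.1, t.2.2))) := by
      refine RunProd.fork _ ?_ ?_
      · simpa [Function.comp_def] using hf
      · simpa [Function.comp_def] using hj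
    rw [Multiset.map_coe, List.map_map] at hprod
    exact .trans (.of_mem_prods hprod)
      (derives_branches (G := A.runGrammar p q) id l (fun t ht w hw => ih t ht hw) hw)
  | par h =>
    obtain rfl := ParWord.toSP_injective hw
    exact .of_mem_prods (RunProd.par h)

/-- The parallel words accepted by a branching automaton form a semilinear set. -/
theorem isSemilinearSet_language (A : BranchingAutomaton α) :
    IsSemilinearSet {w : ParWord α | w.toSP ∈ A.language} := by
  have := A.finite_state
  have h : {w : ParWord α | w.toSP ∈ A.language} =
      ⋃ p ∈ A.start, ⋃ q ∈ A.final, (A.runGrammar p q).languageFrom (p, q) := by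
    ext w
    simp only [Set.mem_iUnion, exists_prop]
    constructor
    · rintro ⟨p, hp, q, hq, h⟩
      exact ⟨p, hp, q, hq, h.mem_languageFrom rfl⟩
    · rintro ⟨p, hp, q, hq, h⟩
      exact ⟨p, hp, q, hq, run_of_mem_languageFrom h⟩
  rw [h]
  exact .biUnion (Set.toFinite _) fun p _ => .biUnion (Set.toFinite _) fun q _ =>
    ParallelGrammar.isSemilinearSet_languageFrom _ _

end BranchingAutomaton

theorem theorem2 {α : Type*} [Finite α] (L : Set (ParWord α)) :
    List.TFAE [
      IsParallelRegular L,
      ∃ G : ParallelGrammar α, G.IsLinear ∧ G.language = L,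
      ∃ A : BranchingAutomaton α, A.language = ParWord.toSP '' L,
      ∃ A : BranchingAutomaton α, {w : ParWord α | w.toSP ∈ A.language} = L] := by
  tfae_have 1 → 2 := fun h => h.isSemilinearSet.exists_linear_grammar
  tfae_have 2 → 3 := by
    rintro ⟨G, hG, rfl⟩
    exact hG.exists_automaton
  tfae_have 3 → 4 := by
    rintro ⟨A, hA⟩
    refine ⟨A, ?_⟩
    rw [hA]
    exact Set.preimage_image_eq L ParWord.toSP_injective
  tfae_have 4 → 1 := by
    rintro ⟨A, rfl⟩
    exact A.isSemilinearSet_language.isParallelRegular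
  tfae_finish
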